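/- **Setting.** Let $d,n\ge 1$, $m\ge 0$, $r\ge 2$, $N=n+m\ge 2$. Let $\pi_1,\dots,\pi_r>0$, $\sum_k\pi_k=1$, and let $\mathcal D_1,\dots,\mathcal D_r$ be probability distributions on $\mathbb R^d$, where $\mathcal D_k$ has mean $\mu_k$ and is sub-gaussian with parameter $\psi_k>0$. (A law with mean $a$ is sub-gaussian with parameter $\psi$ if $X\sim$ this law satisfies $\mathbb E\,e^{\nu^\top (X-a)}\le e^{\psi^2\|\nu\|^2/2}$ for all vectors $\nu$.) The data are $n$ i.i.d. inliers $y_i$ with labels $\phi_i$, where $\mathbb P(\phi_i=k)=\pi_k$ and $y_i\sim\mathcal D_k$ given $\phi_i=k$, and $m$ outliers with an arbitrary joint law, independent of the inliers; $Y^{\mathcal O}$ is the $m\times d$ matrix of outliers and $\|Y^{\mathcal O}\|_{2,\infty}$ is its largest row norm ($0$ if $m=0$). Let $\sigma_k^2$ be the largest eigenvalue of the second moment matrix of $X-\mu_k$, $X\sim\mathcal D_k$, let $\sigma_{\max}=\max_k\sigma_k$, and let $\Delta_{\min},\Delta_{\max}$ be the minimum and maximum of $\|\mu_k-\mu_l\|$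 over $k\ne l$. Assume that $\sum_k\pi_k\mu_k=0$, that $\mu_1,\dots,\mu_r$ span an $(r-1)$-dimensional space, and let $K>0$ be a sub-gaussian parameter of the (mean zero) inlier distribution $\sum_k\pi_k\mathcal D_k$. Let $0<\alpha<1$ be such that $N_2=N^\alpha$ is an integer. Independently of the data, choose a uniformly random set $P_2$ of $N_2$ of the $N$ indices, and let $P_1$ be its complement. Let $V\in\mathbb R^{d\times(r-1)}$ have as columns orthonormal eigenvectors for the $r-1$ largest eigenvalues of the sample covariance matrix $\hat\Sigma_2=\frac1{N_2}\sum_{i\in P_2}(y_i-\bar y_2)(y_i-\bar y_2)^\top$, $\bar y_2=\frac1{N_2}\sum_{i\in P_2}y_i$ (chosen measurably from the points in $P_2$), and put $y_i'=V^\top y_i$ for $i\in P_1$. **Proposition.** There are universal constants $c_1,C_2,C>0$ and $a\in\mathbb N$ with the following property. Suppose that the smallest positive eigenvalue $\eta_{r-1}(H)$ of $H=\sum_k\pi_k\mu_k\mu_k^\top$ satisfies, almost surely, $$\eta_{r-1}(H)>5\Big(\sigma_{\max}^2+C_1\sqrt{\tfrac{2\alpha d N^{1-\alpha}\log N}{n}}+C_2\Big(\tfrac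 mN+\sqrt{\tfrac{\alpha\log N}{N^\alpha}}\Big)\max\{\Delta_{\max}^2,\|Y^{\mathcal O}\|_{2,\infty}^2\}\Big),\qquad C_1=c_1K^2 .$$ Then: 1. Conditionally on $P_2$ and on the points $(y_i)_{i\in P_2}$, the pairs $(\phi_i,y_i')$ of the inliers $i\in P_1$ are independent and identically distributed, with $\phi_i=k$ with probability $\pi_k$ and $y_i'$ given $\phi_i=k$ distributed as $V^\top X$, $X\sim\mathcal D_k$; this law on $\mathbb R^{r-1}$ has mean $V^\top\mu_k$ and is sub-gaussian with parameter $\psi_k$. 2. With probability at least $1-C\,r^2(\log N)^a N^{-\alpha}$, i.e. $1-\tilde O(r^2N^{-\alpha})$, $$\min_{k\neq l}\|V^\top\mu_k-V^\top\mu_l\|\ \ge\ \tfrac12\Delta_{\min}.$$ -/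

import Mathlib

open MeasureTheory ProbabilityTheory
open scoped Matrix BigOperators

noncomputable section

namespace SGMM

/-- `ℝ^d` with the Euclidean norm. -/
abbrev E (d : ℕ) : Type := EuclideanSpace ℝ (Fin d)

instance instStandardBorelE (d : ℕ) : StandardBorelSpace (E d) :=
  standardBorel_of_polish

instance instStandardBorelLabelled (r d : ℕ) : StandardBorelSpace (Fin r × E d) :=
  StandardBorelSpace.prod

/-- The law `D` on `ℝ^d` has mean `a` and is sub-gaussian with parameter `ψ`:
`𝔼 exp ⟪ν, X - a⟫ ≤ exp (ψ² ‖ν‖² / 2)` for all `ν`. -/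
structure IsSubGaussian {d : ℕ} (D : Measure (E d)) (a : E d) (ψ : ℝ) : Prop where
  pos : 0 < ψ
  integrable : Integrable (fun x => x) D
  mean : ∫ x, x ∂D = a
  integrable_exp : ∀ ν : E d, Integrable (fun x => Real.exp (inner ℝ ν (x - a))) D
  mgf_le : ∀ ν : E d,
    ∫ x, Real.exp (inner ℝ ν (x - a)) ∂D ≤ Real.exp (ψ ^ 2 * ‖ν‖ ^ 2 / 2)

/-- Joint law of a label and a point: the label is `k` with probability `w k`, and, given the
label `k`, the point has law `D k`. -/
def labelledMixture {r d : ℕ} (w : Fin r → ℝ) (D : Fin r → Measure (E d)) :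
    Measure (Fin r × E d) :=
  ∑ k, ENNReal.ofReal (w k) • (Measure.dirac k).prod (D k)

/-- Second moment matrix of `X - a`, where `X` has law `D`. -/
def secondMoment {d : ℕ} (D : Measure (E d)) (a : E d) : Matrix (Fin d) (Fin d) ℝ :=
  Matrix.of fun i j => ∫ x, (x i - a i) * (x j - a j) ∂D

/-- Largest (real) eigenvalue. -/
def maxEigenvalue {d : ℕ} (A : Matrix (Fin d) (Fin d) ℝ) : ℝ := sSup (spectrum ℝ A)

/-- Smallest positive (real) eigenvalue. -/
def minPosEigenvalue {d : ℕ} (A : Matrix (Fin d) (Fin d) ℝ) : ℝ :=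
  sInf {t | t ∈ spectrum ℝ A ∧ 0 < t}

/-- `σ_max = max_k σ_k`, with `σ_k²` the largest eigenvalue of the second moment matrix of the
noise of the `k`-th component. -/
def sigmaMax {r d : ℕ} (D : Fin r → Measure (E d)) (μ : Fin r → E d) : ℝ :=
  ⨆ k, √(maxEigenvalue (secondMoment (D k) (μ k)))

/-- `Δ_min = min_{k ≠ l} ‖μ_k - μ_l‖`. -/
def minSep {r d : ℕ} (μ : Fin r → E d) : ℝ :=
  ⨅ p : {p : Fin r × Fin r // p.1 ≠ p.2}, ‖μ p.1.1 - μ p.1.2‖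

/-- `Δ_max = max_{k ≠ l} ‖μ_k - μ_l‖`. -/
def maxSep {r d : ℕ} (μ : Fin r → E d) : ℝ :=
  ⨆ p : {p : Fin r × Fin r // p.1 ≠ p.2}, ‖μ p.1.1 - μ p.1.2‖

/-- `H = ∑_k π_k μ_k μ_kᵀ`. -/
def meanMatrix {r d : ℕ} (w : Fin r → ℝ) (μ : Fin r → E d) : Matrix (Fin d) (Fin d) ℝ :=
  ∑ k, w k • Matrix.vecMulVec (μ k) (μ k)

/-- `‖Y‖_{2,∞}`, the largest Euclidean norm of a row (`0` if there are no rows). -/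
def rowNorm {m d : ℕ} (Y : Fin m → E d) : ℝ := ⨆ j, ‖Y j‖

/-- Sample mean of a finite family of points. -/
def sampleMean {ι : Type*} [Fintype ι] {d : ℕ} (z : ι → E d) : E d :=
  (Fintype.card ι : ℝ)⁻¹ • ∑ p, z p

/-- Sample covariance matrix of a finite family of points. -/
def sampleCov {ι : Type*} [Fintype ι] {d : ℕ} (z : ι → E d) : Matrix (Fin d) (Fin d) ℝ :=
  (Fintype.card ι : ℝ)⁻¹ •
    ∑ p, Matrix.vecMulVec (z p - sampleMean z) (z p - sampleMean z)

/-- The columns of `V` are orthonormal eigenvectors of the symmetric matrix `A` which belong to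
its `q` largest eigenvalues (with multiplicity; ties are broken arbitrarily): on the orthogonal
complement of the columns the quadratic form of `A` is at most each of the chosen eigenvalues. -/
def IsTopEigenvectors {d q : ℕ} (A : Matrix (Fin d) (Fin d) ℝ)
    (V : Matrix (Fin d) (Fin q) ℝ) : Prop :=
  Vᵀ * V = 1 ∧ ∃ t : Fin q → ℝ, A * V = V * Matrix.diagonal t ∧
    ∀ (j : Fin q) (x : Fin d → ℝ), Vᵀ *ᵥ x = 0 → x ⬝ᵥ (A *ᵥ x) ≤ t j * (x ⬝ᵥ x)

/-- The projection `x ↦ Vᵀ x`. -/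
def proj {d q : ℕ} (V : Matrix (Fin d) (Fin q) ℝ) (x : E d) : E q :=
  WithLp.toLp 2 (Vᵀ *ᵥ x.ofLp)

/-- The data model. Points `inl i` are the `n` inliers, points `inr j` the `m` outliers.
The inliers with their labels are i.i.d. from the mixture; the outliers have an arbitrary joint
law and are independent of the inliers. -/
structure IsSample {Ω : Type*} [MeasurableSpace Ω] (Pr : Measure Ω) {n m d r : ℕ}
    (w : Fin r → ℝ) (D : Fin r → Measure (E d))
    (φ : Fin n → Ω → Fin r) (y : Fin n ⊕ Fin m → Ω → E d) : Prop where
  measurable_label : ∀ i, Measurable (φ i)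
  measurable_point : ∀ p, Measurable (y p)
  inlier_law : ∀ i, Pr.map (fun ω => (φ i ω, y (Sum.inl i) ω)) = labelledMixture w D
  inlier_indep : iIndepFun (fun i ω => (φ i ω, y (Sum.inl i) ω)) Pr
  outlier_indep : IndepFun (fun ω (i : Fin n) => (φ i ω, y (Sum.inl i) ω))
    (fun ω (j : Fin m) => y (Sum.inr j) ω) Pr

/-- `P` is a uniformly random set of `N₂` of the `n + m` indices, independent of the data. -/
structure IsRandomSplit {Ω : Type*} [MeasurableSpace Ω] (Pr : Measure Ω) {n m d r : ℕ}
    (φ : Fin n → Ω → Fin r) (y : Fin n ⊕ Fin m → Ω → E d)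
    (N₂ : ℕ) (P : Ω → Finset (Fin n ⊕ Fin m)) : Prop where
  measurable : Measurable P
  card_eq : ∀ ω, (P ω).card = N₂
  uniform : ∀ S : Finset (Fin n ⊕ Fin m), S.card = N₂ →
    Pr (P ⁻¹' {S}) = ((n + m).choose N₂ : ENNReal)⁻¹
  indep : IndepFun P (fun ω => ((fun i : Fin n => φ i ω), (fun p => y p ω))) Pr

/-- `V` is a principal component map: for every `S` of size `N₂` and every family `z` of points
indexed by `S`, the columns of `V S z` are top `q` eigenvectors of the sample covariance matrix
of `z`, chosen measurably in `z`. -/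
structure IsPCA {ι : Type*} {d q : ℕ} (N₂ : ℕ)
    (V : (S : Finset ι) → (S → E d) → Matrix (Fin d) (Fin q) ℝ) : Prop where
  measurable : ∀ (S : Finset ι) (a : Fin d) (b : Fin q), Measurable fun z => V S z a b
  top : ∀ (S : Finset ι), S.card = N₂ → ∀ z : S → E d,
    IsTopEigenvectors (sampleCov z) (V S z)

end SGMM

end

/-! Part 1 is independence. An inlier outside of the split is independent of the points inside it,
and the split is independent of all data, so conditioning on the split and its points leaves the law
of the remaining inliers unchanged. The matrix `V` is a function of the conditioning variables and
may be frozen (`condDistrib_eq_map_of_map_prodMk_eq_prod`, `condDistrib_projected_inliers`). Since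
`V` has orthonormal columns, its adjoint is an isometry and the sub-gaussian parameter survives
(`IsSubGaussian.map_proj`).

Part 2 is deterministic perturbation theory on a good event. Suppose the quadratic form of the
sample covariance differs from that of `H` by at most `δ`, with `5 δ` below the smallest positive
eigenvalue of `H`. A one-sided `sin Θ` bound (`norm_sub_sum_le_of_top_eigenvectors`) then shows that
any vector in the span of the means loses at most `2/5` of its length outside of the principal
subspace. In particular, the differences of the means keep at least half their length
(`norm_le_two_mul_norm_proj`).

The value of `δ` comes from `abs_sampleCov_sub_le`. The second moments of the mixture exceed `H` by
at most `sigmaMax ^ 2`. The inlier fluctuations are controlled by a Bernstein bound for squares of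
sub-gaussian variables on a net of directions (`exists_measurableSet_concentration`). The outliers
cost a multiple of their fraction in the split, and this fraction is close to `m / N` by an
exponential moment bound for the hypergeometric law (`card_filter_lt_card_toRight_le`). For a split
of size `M` the exceptional events have total probability at most `5 / M`.

Concentration needs `d ≤ M`, which is not assumed. It follows from the eigenvalue condition: the
smallest positive eigenvalue of `H` is at most `8 K ^ 2` (`minPosEigenvalue_le`), so the condition
itself forces `d log M / M` to be small. -/

namespace SGMM

/-! ### Perturbation of top eigenspaces of symmetric operators. -/

section PCA

variable {F : Type*} [NormedAddCommGroup F] [InnerProductSpace ℝ F]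

/-- A bound on the quadratic form of a symmetric operator bounds its bilinear form. -/
lemma abs_inner_le_of_abs_quadratic_le {T : F →ₗ[ℝ] F} (hT : T.IsSymmetric)
    (W : Submodule ℝ F) {a : ℝ}
    (h : ∀ z ∈ W, |inner ℝ (T z) z| ≤ a * ‖z‖ ^ 2) {x y : F} (hx : x ∈ W) (hy : y ∈ W) :
    |inner ℝ (T x) y| ≤ a * ‖x‖ * ‖y‖ := by
  -- Polarisation and the parallelogram law.
  have key : ∀ x ∈ W, ∀ y ∈ W, 2 * |inner ℝ (T x) y| ≤ a * (‖x‖ ^ 2 + ‖y‖ ^ 2) := by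
    intro x hx y hy
    have h1 := h _ (W.add_mem hx hy)
    have h2 := h _ (W.sub_mem hx hy)
    have e1 : inner ℝ (T (x + y)) (x + y) - inner ℝ (T (x - y)) (x - y)
        = 4 * inner ℝ (T x) y := by
      have : inner ℝ (T y) x = inner ℝ (T x) y := by rw [hT y x, real_inner_comm]
      simp only [map_add, map_sub, inner_add_left, inner_add_right, inner_sub_left,
        inner_sub_right, this]
      ring
    have e2 := parallelogram_law_with_norm ℝ x y
    have h3 : |4 * inner ℝ (T x) y| ≤ a * ‖x + y‖ ^ 2 + a * ‖x - y‖ ^ 2 := by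
      rw [← e1]
      exact (abs_sub _ _).trans (add_le_add h1 h2)
    rw [abs_mul, abs_of_pos (by norm_num : (0 : ℝ) < 4)] at h3
    have e3 : a * ‖x + y‖ ^ 2 + a * ‖x - y‖ ^ 2 = 2 * (a * (‖x‖ ^ 2 + ‖y‖ ^ 2)) := by
      linear_combination a * e2
    linarith
  rcases eq_or_ne x 0 with rfl | hx0
  · simp
  rcases eq_or_ne y 0 with rfl | hy0
  · simp
  -- After this rescaling both vectors have norm `‖x‖ * ‖y‖`, so the sum of squares in `key` becomes
  -- twice a product.
  have h1 := key _ (W.smul_mem ‖y‖ hx) _ (W.smul_mem ‖x‖ hy)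
  have hp : 0 < ‖x‖ * ‖y‖ := mul_pos (norm_pos_iff.2 hx0) (norm_pos_iff.2 hy0)
  rw [map_smul, real_inner_smul_left, real_inner_smul_right, norm_smul, norm_smul, norm_norm,
    norm_norm, ← mul_assoc, abs_mul, abs_of_nonneg (by positivity : 0 ≤ ‖y‖ * ‖x‖)] at h1
  refine le_of_mul_le_mul_left ?_ hp
  nlinarith

variable [FiniteDimensional ℝ F] {q : ℕ} {T H : F →ₗ[ℝ] F} {v : Fin q → F} {t : Fin q → ℝ}
  {U : Submodule ℝ F} {η δ : ℝ}

/-- Outside of the span of its top `q` eigenvectors, the form of `T` is bounded by the distance of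
`T` to an operator that vanishes in codimension `q`. -/
lemma inner_le_of_forall_inner_eq_zero (hv : Orthonormal ℝ v)
    (hTs : T.IsSymmetric) (hTv : ∀ j, T (v j) = t j • v j)
    (htop : ∀ j x, (∀ i, inner ℝ (v i) x = 0) → inner ℝ (T x) x ≤ t j * ‖x‖ ^ 2)
    (hU : Module.finrank ℝ U = q) (hH : ∀ x ∈ Uᗮ, H x = 0)
    (hB : ∀ x, |inner ℝ ((T - H) x) x| ≤ δ * ‖x‖ ^ 2) {w : F}
    (hw : ∀ i, inner ℝ (v i) w = 0) : inner ℝ (T w) w ≤ δ * ‖w‖ ^ 2 := by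
  classical
  rcases eq_or_ne w 0 with rfl | hw0
  · simp
  let f : (Fin q → ℝ) × ℝ →ₗ[ℝ] F :=
    (Fintype.linearCombination ℝ v).coprod (LinearMap.toSpanSingleton ℝ F w)
  have hf : ∀ c s, f (c, s) = ∑ j, c j • v j + s • w := fun c s => by
    simp [f, Fintype.linearCombination_apply, LinearMap.toSpanSingleton_apply]
  -- Courant–Fischer dimension count: the `v j` together with `w` give `q + 1` parameters and `U`
  -- has dimension `q`, so some nonzero combination lies in `Uᗮ`, where `H` vanishes.
  have hker : LinearMap.ker (U.orthogonalProjectionOnto.toLinearMap ∘ₗ f) ≠ ⊥ := by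
    apply LinearMap.ker_ne_bot_of_finrank_lt
    simp [hU]
  obtain ⟨⟨c, s⟩, hcs, hne⟩ := Submodule.exists_mem_ne_zero_of_ne_bot hker
  have hz : f (c, s) ∈ Uᗮ := by
    rw [← Submodule.orthogonalProjectionOnto_eq_zero_iff]
    simpa using hcs
  have hsum : ∀ i, inner ℝ (v i) (∑ j, c j • v j) = c i := fun i => hv.inner_right_fintype c i
  have hsw : inner ℝ (∑ j, c j • v j) w = 0 := by
    simp [sum_inner, real_inner_smul_left, hw]
  have hn : ‖f (c, s)‖ ^ 2 = ∑ j, c j ^ 2 + s ^ 2 * ‖w‖ ^ 2 := by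
    rw [hf, ← real_inner_self_eq_norm_sq, inner_add_left, inner_add_right, inner_add_right,
      real_inner_smul_right, hsw, real_inner_smul_left, real_inner_comm _ w, hsw,
      real_inner_smul_left, real_inner_smul_right, real_inner_self_eq_norm_sq w, sum_inner]
    simp only [real_inner_smul_left, hsum]
    simp [sq, mul_assoc]
  have hTw : ∀ i, inner ℝ (v i) (T w) = 0 := fun i => by
    rw [← hTs, hTv, real_inner_smul_left, hw, mul_zero]
  have hq : inner ℝ (T (f (c, s))) (f (c, s)) = ∑ j, t j * c j ^ 2 + s ^ 2 * inner ℝ (T w) w := by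
    rw [hf, map_add, map_sum, map_smul, inner_add_left, inner_add_right, inner_add_right,
      real_inner_smul_left, real_inner_smul_left, real_inner_smul_right, real_inner_smul_right]
    have h1 : inner ℝ (∑ j, T (c j • v j)) w = 0 := by
      simp [sum_inner, hTv, real_inner_smul_left, hw]
    have h2 : inner ℝ (T w) (∑ j, c j • v j) = 0 := by
      rw [real_inner_comm]
      simp [sum_inner, real_inner_smul_left, hTw]
    rw [h1, h2, sum_inner]
    simp only [map_smul, hTv, real_inner_smul_left, hsum]
    simp only [mul_zero, add_zero, zero_add]
    congr 1
    · exact Finset.sum_congr rfl fun j _ => by ring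
    · ring
  have hpos : 0 < ‖f (c, s)‖ ^ 2 := by
    rw [hn]
    by_contra hle
    have hw2 : 0 < ‖w‖ ^ 2 := by positivity
    have h1 : 0 ≤ ∑ j, c j ^ 2 := Finset.sum_nonneg fun j _ => sq_nonneg _
    have h2 : 0 ≤ s ^ 2 * ‖w‖ ^ 2 := by positivity
    have h3 : ∑ j, c j ^ 2 = 0 := by linarith
    have h4 : s = 0 := by
      have : s ^ 2 * ‖w‖ ^ 2 = 0 := by linarith
      simpa [hw0] using this
    rw [Finset.sum_eq_zero_iff_of_nonneg fun j _ => sq_nonneg _] at h3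
    apply hne
    ext j
    · simpa using h3 j (Finset.mem_univ j)
    · exact h4
  have hle : inner ℝ (T (f (c, s))) (f (c, s)) ≤ δ * ‖f (c, s)‖ ^ 2 := by
    have := (abs_le.1 (hB (f (c, s)))).2
    rwa [LinearMap.sub_apply, hH _ hz, sub_zero] at this
  -- Each `t j` is at least the Rayleigh quotient of `w`, so replacing `w` by the combination can
  -- only raise the quotient.
  have hsumle : inner ℝ (T w) w * ∑ j, c j ^ 2 ≤ ‖w‖ ^ 2 * ∑ j, t j * c j ^ 2 := by
    rw [Finset.mul_sum, Finset.mul_sum]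
    refine Finset.sum_le_sum fun j _ => ?_
    have := mul_le_mul_of_nonneg_right (htop j w hw) (sq_nonneg (c j))
    linarith
  refine le_of_mul_le_mul_right ?_ hpos
  calc inner ℝ (T w) w * ‖f (c, s)‖ ^ 2
      ≤ ‖w‖ ^ 2 * inner ℝ (T (f (c, s))) (f (c, s)) := by rw [hn, hq]; linarith
    _ ≤ ‖w‖ ^ 2 * (δ * ‖f (c, s)‖ ^ 2) := by gcongr
    _ = _ := by ring

/-- A one-sided `sin Θ` bound for the span of the top eigenvectors. -/
theorem norm_sub_sum_le_of_top_eigenvectors (hv : Orthonormal ℝ v)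
    (hTs : T.IsSymmetric) (hHs : H.IsSymmetric) (hTv : ∀ j, T (v j) = t j • v j)
    (htop : ∀ j x, (∀ i, inner ℝ (v i) x = 0) → inner ℝ (T x) x ≤ t j * ‖x‖ ^ 2)
    (hTpos : ∀ x, 0 ≤ inner ℝ (T x) x)
    (hU : Module.finrank ℝ U = q) (hH : ∀ x ∈ Uᗮ, H x = 0)
    (hη : 0 < η) (hHU : ∀ x ∈ U, η * ‖x‖ ^ 2 ≤ inner ℝ (H x) x)
    (hB : ∀ x, |inner ℝ ((T - H) x) x| ≤ δ * ‖x‖ ^ 2) {x : F} (hx : x ∈ U) :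
    η * ‖x - ∑ j, inner ℝ (v j) x • v j‖ ≤ 2 * δ * ‖x‖ := by
  classical
  have hrange : ∀ z, H z ∈ U := fun z => by
    rw [← Submodule.orthogonal_orthogonal U, Submodule.mem_orthogonal]
    intro u hu
    rw [← hHs, hH u hu, inner_zero_left]
  -- Coercivity makes `H` bijective on `U`, so `x = H z` with `‖z‖ ≤ ‖x‖ / η`. Solving for `z`
  -- replaces any assumption of a spectral gap for `T`.
  have hinj : Function.Injective (H.restrict (p := U) (q := U) fun z _ => hrange z) := by
    rw [← LinearMap.ker_eq_bot, LinearMap.ker_eq_bot']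
    rintro ⟨z, hz⟩ h0
    have h1 : H z = 0 := congrArg Subtype.val h0
    have h2 := hHU z hz
    rw [h1, inner_zero_left] at h2
    have h3 : ‖z‖ ^ 2 = 0 := le_antisymm (by
      by_contra h4
      push Not at h4
      nlinarith) (by positivity)
    simpa using h3
  obtain ⟨⟨z, hz⟩, hHz'⟩ := LinearMap.injective_iff_surjective.1 hinj ⟨x, hx⟩
  have hHz : H z = x := congrArg Subtype.val hHz'
  have hnz : η * ‖z‖ ≤ ‖x‖ := by
    rcases eq_or_ne z 0 with rfl | h0
    · simp
    · have h1 := (hHU z hz).trans (real_inner_le_norm _ _)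
      rw [hHz] at h1
      refine le_of_mul_le_mul_right ?_ (norm_pos_iff.2 h0)
      linarith [h1, sq ‖z‖]
  let W : Submodule ℝ F := (Submodule.span ℝ (Set.range v))ᗮ
  have hW : ∀ y, y ∈ W ↔ ∀ i, inner ℝ (v i) y = 0 := fun y => by
    constructor
    · exact fun h i => (Submodule.mem_orthogonal _ _).1 h _ (Submodule.subset_span ⟨i, rfl⟩)
    · intro h
      rw [Submodule.mem_orthogonal]
      intro u hu
      induction hu using Submodule.span_induction with
      | mem u hu => obtain ⟨i, rfl⟩ := hu; exact h i
      | zero => simp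
      | add a b _ _ ha hb => rw [inner_add_left, ha, hb, add_zero]
      | smul c a _ ha => rw [real_inner_smul_left, ha, mul_zero]
  have hQ : ∀ y, y - ∑ j, inner ℝ (v j) y • v j ∈ W := fun y => by
    rw [hW]
    intro i
    rw [inner_sub_right, hv.inner_right_fintype, sub_self]
  have hform : ∀ y ∈ W, |inner ℝ (T y) y| ≤ δ * ‖y‖ ^ 2 := fun y hy => by
    rw [abs_of_nonneg (hTpos y)]
    exact inner_le_of_forall_inner_eq_zero hv hTs hTv htop hU hH hB ((hW y).1 hy)
  have hTW : ∀ y ∈ W, T y ∈ W := fun y hy => by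
    rw [hW] at hy ⊢
    intro i
    rw [← hTs, hTv, real_inner_smul_left, hy, mul_zero]
  set Qx := x - ∑ j, inner ℝ (v j) x • v j with hQx
  set Qz := z - ∑ j, inner ℝ (v j) z • v j with hQz
  have horth : ∀ y ∈ W, ∀ c : Fin q → ℝ, inner ℝ y (∑ j, c j • v j) = 0 := fun y hy c => by
    rw [real_inner_comm]
    simp [sum_inner, real_inner_smul_left, (hW y).1 hy]
  -- The key identity: substitute `x = H z`, move `H` to the other side and write `H = T - (T - H)`.
  -- As `T` preserves `W`, only the `W`-component of `z` meets `T Qx`. Both terms are then at most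
  -- `δ * ‖Qx‖ * ‖z‖`, which accounts for the factor `2`.
  have h1 : ‖Qx‖ ^ 2 = inner ℝ (T Qx) Qz - inner ℝ ((T - H) Qx) z := by
    have e1 : inner ℝ Qx x = ‖Qx‖ ^ 2 := by
      have : x = Qx + ∑ j, inner ℝ (v j) x • v j := by rw [hQx]; abel
      conv_lhs => rw [this]
      rw [inner_add_right, horth _ (hQ x), add_zero, real_inner_self_eq_norm_sq]
    have e2 : inner ℝ (T Qx) z = inner ℝ (T Qx) Qz := by
      have : z = Qz + ∑ j, inner ℝ (v j) z • v j := by rw [hQz]; abel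
      conv_lhs => rw [this]
      rw [inner_add_right, horth _ (hTW _ (hQ x)), add_zero]
    rw [LinearMap.sub_apply, inner_sub_left, e2, hHs, hHz, e1]
    ring
  have hδz : 0 ≤ δ * ‖z‖ ^ 2 := (abs_nonneg _).trans (hB z)
  have hQzn : ‖Qz‖ ≤ ‖z‖ := by
    have : ‖z‖ ^ 2 = ‖Qz‖ ^ 2 + ‖∑ j, inner ℝ (v j) z • v j‖ ^ 2 := by
      have e : z = Qz + ∑ j, inner ℝ (v j) z • v j := by rw [hQz]; abel
      conv_lhs => rw [e]
      rw [norm_add_sq_real, horth _ (hQ z)]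
      ring
    refine le_of_sq_le_sq ?_ (norm_nonneg _)
    nlinarith [sq_nonneg ‖∑ j, inner ℝ (v j) z • v j‖]
  rcases eq_or_ne Qx 0 with h0 | h0
  · have hδx : 0 ≤ δ * ‖x‖ ^ 2 := (abs_nonneg _).trans (hB x)
    rw [h0, norm_zero, mul_zero]
    rcases eq_or_ne x 0 with hx0 | hx0
    · simp [hx0]
    · have : 0 < ‖x‖ := norm_pos_iff.2 hx0
      have : 0 ≤ δ := by
        by_contra h
        push Not at h
        nlinarith [mul_pos this this]
      positivity
  have hp : 0 < ‖Qx‖ := norm_pos_iff.2 h0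
  have hδ : 0 ≤ δ := by
    have h2 := (abs_nonneg _).trans (hB Qx)
    by_contra h
    push Not at h
    nlinarith [mul_pos hp hp]
  have hBs : (T - H).IsSymmetric := fun a b => by
    simp only [LinearMap.sub_apply, inner_sub_left, inner_sub_right, hTs a b, hHs a b]
  have h2 := abs_inner_le_of_abs_quadratic_le hTs W hform (hQ x) (hQ z)
  have h3 := abs_inner_le_of_abs_quadratic_le hBs ⊤ (fun y _ => hB y)
    (Submodule.mem_top (x := Qx)) (Submodule.mem_top (x := z))
  have h4 : ‖Qx‖ * ‖Qx‖ ≤ ‖Qx‖ * (2 * δ * ‖z‖) := by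
    have h5 := (abs_le.1 h2).2
    have h6 := (abs_le.1 h3).1
    have h7 : δ * ‖Qx‖ * ‖Qz‖ ≤ δ * ‖Qx‖ * ‖z‖ := by gcongr
    nlinarith
  have h5 := le_of_mul_le_mul_left h4 hp
  calc η * ‖Qx‖ ≤ η * (2 * δ * ‖z‖) := by gcongr
    _ = 2 * δ * (η * ‖z‖) := by ring
    _ ≤ _ := by gcongr

end PCA

end SGMM

namespace SGMM

/-! ### Quadratic forms of symmetric matrices and their extreme eigenvalues. -/

section Spectral

variable {d : ℕ}

lemma inner_toLp_mulVec (A : Matrix (Fin d) (Fin d) ℝ) (x y : E d) :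
    inner ℝ (WithLp.toLp 2 (A *ᵥ x.ofLp)) y = y.ofLp ⬝ᵥ (A *ᵥ x.ofLp) := by
  simp [PiLp.inner_apply, dotProduct]

lemma dotProduct_self_eq_norm_sq (x : E d) : x.ofLp ⬝ᵥ x.ofLp = ‖x‖ ^ 2 := by
  rw [EuclideanSpace.norm_sq_eq]
  simp [dotProduct, sq]

lemma dotProduct_vecMulVec_mulVec (u : E d) (x y : E d) :
    y.ofLp ⬝ᵥ (Matrix.vecMulVec u.ofLp u.ofLp *ᵥ x.ofLp) = inner ℝ u x * inner ℝ u y := by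
  rw [Matrix.vecMulVec_mulVec, dotProduct_smul]
  simp [PiLp.inner_apply, dotProduct, mul_comm]

/-- The quadratic form of a symmetric matrix in a basis of eigenvectors. -/
lemma dotProduct_mulVec_eq_sum_eigenvalues {A : Matrix (Fin d) (Fin d) ℝ} (hA : A.IsHermitian)
    (x : E d) : x.ofLp ⬝ᵥ (A *ᵥ x.ofLp)
      = ∑ i, hA.eigenvalues i * inner ℝ (hA.eigenvectorBasis i) x ^ 2 := by
  have hs : (Matrix.toEuclideanLin A).IsSymmetric := Matrix.isSymmetric_toEuclideanLin_iff.2 hA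
  have h1 : x.ofLp ⬝ᵥ (A *ᵥ x.ofLp) = inner ℝ (Matrix.toEuclideanLin A x) x :=
    (inner_toLp_mulVec A x x).symm
  rw [h1, ← hA.eigenvectorBasis.sum_inner_mul_inner]
  refine Finset.sum_congr rfl fun i _ => ?_
  rw [hs x]
  have h2 : Matrix.toEuclideanLin A (hA.eigenvectorBasis i)
      = hA.eigenvalues i • hA.eigenvectorBasis i := by
    ext j
    simpa using congrFun (hA.mulVec_eigenvectorBasis i) j
  rw [h2, real_inner_smul_right, real_inner_comm]
  ring

lemma dotProduct_mulVec_le_maxEigenvalue {A : Matrix (Fin d) (Fin d) ℝ} (hA : A.IsHermitian)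
    (x : E d) : x.ofLp ⬝ᵥ (A *ᵥ x.ofLp) ≤ maxEigenvalue A * ‖x‖ ^ 2 := by
  rw [dotProduct_mulVec_eq_sum_eigenvalues hA, ← hA.eigenvectorBasis.sum_sq_norm_inner_right x,
    Finset.mul_sum]
  refine Finset.sum_le_sum fun i _ => ?_
  rw [Real.norm_eq_abs, sq_abs]
  gcongr
  exact le_csSup (Matrix.finite_real_spectrum (A := A)).bddAbove (hA.eigenvalues_mem_spectrum_real i)

variable {r : ℕ} (w : Fin r → ℝ) (μ : Fin r → E d)

lemma isHermitian_meanMatrix : (meanMatrix w μ).IsHermitian := by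
  ext i j
  simp [meanMatrix, Matrix.sum_apply, Matrix.vecMulVec_apply, mul_comm]

lemma dotProduct_meanMatrix_mulVec (x y : E d) :
    y.ofLp ⬝ᵥ (meanMatrix w μ *ᵥ x.ofLp) = ∑ k, w k * (inner ℝ (μ k) x * inner ℝ (μ k) y) := by
  rw [meanMatrix, Matrix.sum_mulVec, dotProduct_sum]
  refine Finset.sum_congr rfl fun k _ => ?_
  rw [Matrix.smul_mulVec, dotProduct_smul, dotProduct_vecMulVec_mulVec, smul_eq_mul]

variable {w μ}

/-- An eigenvector with eigenvalue `0` is orthogonal to every mean because all weights are positive,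
so a vector in their span has no component along it. Every other eigenvalue is positive and enters
the infimum. -/
lemma minPosEigenvalue_mul_norm_sq_le (hw : ∀ k, 0 < w k) {x : E d}
    (hx : x ∈ Submodule.span ℝ (Set.range μ)) :
    minPosEigenvalue (meanMatrix w μ) * ‖x‖ ^ 2 ≤ ∑ k, w k * inner ℝ (μ k) x ^ 2 := by
  have hA := isHermitian_meanMatrix w μ
  have h1 := dotProduct_meanMatrix_mulVec w μ x x
  simp only [← sq] at h1
  rw [← h1, dotProduct_mulVec_eq_sum_eigenvalues hA,
    ← hA.eigenvectorBasis.sum_sq_norm_inner_right x, Finset.mul_sum]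
  refine Finset.sum_le_sum fun i _ => ?_
  rw [Real.norm_eq_abs, sq_abs]
  set e := hA.eigenvectorBasis i
  have he : hA.eigenvalues i = ∑ k, w k * inner ℝ (μ k) e ^ 2 := by
    have h2 := dotProduct_meanMatrix_mulVec w μ e e
    simp only [← sq] at h2
    rw [← h2, hA.mulVec_eigenvectorBasis, dotProduct_smul, dotProduct_self_eq_norm_sq,
      hA.eigenvectorBasis.norm_eq_one]
    simp
  have he0 : 0 ≤ hA.eigenvalues i := by
    rw [he]
    exact Finset.sum_nonneg fun k _ => mul_nonneg (hw k).le (sq_nonneg _)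
  rcases he0.eq_or_lt with h0 | h0
  · have h3 : ∀ k, inner ℝ (μ k) e = 0 := by
      rw [← h0] at he
      have := (Finset.sum_eq_zero_iff_of_nonneg
        (fun k _ => mul_nonneg (hw k).le (sq_nonneg (inner ℝ (μ k) e)))).1 he.symm
      intro k
      simpa [(hw k).ne'] using this k (Finset.mem_univ k)
    have h4 : inner ℝ x e = 0 := by
      clear h1
      induction hx using Submodule.span_induction with
      | mem u hu => obtain ⟨k, rfl⟩ := hu; exact h3 k
      | zero => simp
      | add a b _ _ ha hb => rw [inner_add_left, ha, hb, add_zero]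
      | smul c a _ ha => rw [real_inner_smul_left, ha, mul_zero]
    rw [real_inner_comm, h4]
    simp
  · gcongr
    exact csInf_le ⟨0, fun t ht => ht.2.le⟩ ⟨hA.eigenvalues_mem_spectrum_real i, h0⟩

end Spectral

/-! ### The projection to the principal components, in coordinates. -/

section Projection

variable {d q : ℕ} {A : Matrix (Fin d) (Fin d) ℝ} {V : Matrix (Fin d) (Fin q) ℝ}

/-- The columns of a matrix as vectors of Euclidean space. -/
def column (V : Matrix (Fin d) (Fin q) ℝ) (j : Fin q) : E d := WithLp.toLp 2 fun i => V i j

lemma proj_apply (V : Matrix (Fin d) (Fin q) ℝ) (x : E d) (j : Fin q) :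
    proj V x j = inner ℝ (column V j) x := by
  simp [proj, column, Matrix.mulVec, dotProduct, PiLp.inner_apply, mul_comm]

lemma orthonormal_column (hV : Vᵀ * V = 1) : Orthonormal ℝ (column V) := by
  rw [orthonormal_iff_ite]
  intro i j
  have := congrFun (congrFun hV i) j
  rw [Matrix.mul_apply, Matrix.one_apply] at this
  rw [← this]
  simp [column, PiLp.inner_apply, mul_comm]

lemma norm_sq_eq_norm_proj_sq_add (hV : Vᵀ * V = 1) (x : E d) :
    ‖x‖ ^ 2 = ‖proj V x‖ ^ 2 + ‖x - ∑ j, inner ℝ (column V j) x • column V j‖ ^ 2 := by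
  have hv := orthonormal_column hV
  set p := ∑ j, inner ℝ (column V j) x • column V j with hp
  have h0 : ‖proj V x‖ ^ 2 = ∑ j, inner ℝ (column V j) x * inner ℝ (column V j) x := by
    simp only [EuclideanSpace.norm_sq_eq, proj_apply, Real.norm_eq_abs, sq_abs, ← sq]
  have h1 : ‖p‖ ^ 2 = ‖proj V x‖ ^ 2 := by
    rw [h0, ← real_inner_self_eq_norm_sq p, hp, sum_inner]
    simp only [real_inner_smul_left, hv.inner_right_fintype]
  have h2 : inner ℝ p x = ‖p‖ ^ 2 := by
    rw [h1, h0, hp, sum_inner]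
    simp only [real_inner_smul_left]
  have h3 := norm_sub_sq_real x p
  rw [real_inner_comm, h2] at h3
  linarith

/-- If `A` is close to `∑ k, w k μ k μ kᵀ`, the projection to the top eigenvectors of `A`
shrinks vectors in the span of the `μ k` by a factor of at most two. -/
theorem norm_le_two_mul_norm_proj {r : ℕ} {w : Fin r → ℝ} {μ : Fin r → E d} {δ : ℝ}
    (hA : A.IsHermitian) (hApos : ∀ x : E d, 0 ≤ x.ofLp ⬝ᵥ (A *ᵥ x.ofLp))
    (hV : IsTopEigenvectors A V) (hw : ∀ k, 0 < w k)
    (hU : Module.finrank ℝ (Submodule.span ℝ (Set.range μ)) = q)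
    (hB : ∀ x : E d,
      |x.ofLp ⬝ᵥ (A *ᵥ x.ofLp) - ∑ k, w k * inner ℝ (μ k) x ^ 2| ≤ δ * ‖x‖ ^ 2)
    (hδ : 0 ≤ δ) (hδη : 5 * δ < minPosEigenvalue (meanMatrix w μ)) {x : E d}
    (hx : x ∈ Submodule.span ℝ (Set.range μ)) : ‖x‖ ≤ 2 * ‖proj V x‖ := by
  obtain ⟨hVV, t, hAV, htop⟩ := hV
  have hinner : ∀ (M : Matrix (Fin d) (Fin d) ℝ) (a b : E d),
      inner ℝ (Matrix.toEuclideanLin M a) b = b.ofLp ⬝ᵥ (M *ᵥ a.ofLp) := inner_toLp_mulVec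
  have hmean : ∀ a, inner ℝ (Matrix.toEuclideanLin (meanMatrix w μ) a) a
      = ∑ k, w k * inner ℝ (μ k) a ^ 2 := fun a => by
    rw [hinner, dotProduct_meanMatrix_mulVec]
    simp only [sq]
  have hη : 0 < minPosEigenvalue (meanMatrix w μ) := by linarith
  have key := norm_sub_sum_le_of_top_eigenvectors (T := Matrix.toEuclideanLin A)
    (H := Matrix.toEuclideanLin (meanMatrix w μ)) (t := t) (η := minPosEigenvalue (meanMatrix w μ))
    (δ := δ) (orthonormal_column hVV)
    (Matrix.isSymmetric_toEuclideanLin_iff.2 hA)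
    (Matrix.isSymmetric_toEuclideanLin_iff.2 (isHermitian_meanMatrix w μ))
    (fun j => by
      ext i
      have := congrFun (congrFun hAV i) j
      rw [Matrix.mul_diagonal, Matrix.mul_apply] at this
      simpa [column, Matrix.mulVec, dotProduct, mul_comm] using this)
    (fun j y hy => by
      rw [hinner, ← dotProduct_self_eq_norm_sq]
      refine htop j _ ?_
      ext i
      simpa [← proj_apply, proj] using hy i)
    (fun y => by rw [hinner]; exact hApos y)
    hU
    (fun y hy => by
      have h0 : ∀ k, inner ℝ (μ k) y = 0 := fun k =>
        (Submodule.mem_orthogonal _ _).1 hy _ (Submodule.subset_span ⟨k, rfl⟩)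
      rw [← inner_self_eq_zero (𝕜 := ℝ), hinner, dotProduct_meanMatrix_mulVec]
      simp [h0])
    hη
    (fun y hy => by
      rw [hmean]
      exact minPosEigenvalue_mul_norm_sq_le hw hy)
    (fun y => by
      rw [LinearMap.sub_apply, inner_sub_left, hinner, hmean]
      exact hB y) hx
  have h1 := norm_sq_eq_norm_proj_sq_add hVV x
  set Q := ‖x - ∑ j, inner ℝ (column V j) x • column V j‖
  -- This is `2 δ / η` with `5 δ < η`. By Pythagoras the projection keeps at least `21 / 25` of the
  -- squared norm, more than the required `1 / 4`.
  have h2 : Q ≤ 2 / 5 * ‖x‖ := by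
    refine le_of_mul_le_mul_left ?_ hη
    nlinarith [norm_nonneg x]
  refine le_of_sq_le_sq ?_ (by positivity)
  nlinarith [norm_nonneg x, norm_nonneg (x - ∑ j, inner ℝ (column V j) x • column V j)]

end Projection

end SGMM

namespace SGMM

/-! ### Exponential tail bounds for sums of sub-gaussian variables and of their squares. -/

section Tail

open scoped NNReal ENNReal

variable {Ω : Type*} [MeasurableSpace Ω] {Pr : Measure Ω}

/-- The square of a sub-gaussian variable has an exponential moment. -/
lemma lintegral_exp_sq_div_le [SFinite Pr] {X : Ω → ℝ} {c : ℝ≥0} (hc : 0 < c) (hXm : Measurable X)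
    (hX : HasSubgaussianMGF X c Pr) :
    ∫⁻ ω, ENNReal.ofReal (Real.exp (X ω ^ 2 / (4 * c))) ∂Pr ≤ 3 := by
  have hc' : (0 : ℝ) < c := hc
  -- The square is linearised by an auxiliary standard Gaussian `g`: `exp (a² X² / 2)` is the mean
  -- of `exp (a g X)`. After Tonelli, sub-gaussianity leaves the mean of `exp (g² / 4)`, which is
  -- `√2` because the integrand is `√2` times the density of variance `2`.
  set a : ℝ := √(1 / (2 * c)) with ha
  have ha2 : a ^ 2 = 1 / (2 * c) := Real.sq_sqrt (by positivity)
  have h1 : ∀ ω, ENNReal.ofReal (Real.exp (X ω ^ 2 / (4 * c)))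
      = ∫⁻ g, ENNReal.ofReal (Real.exp (a * g * X ω)) ∂(gaussianReal 0 1) := fun ω => by
    have h2 : ∀ g : ℝ, a * g * X ω = (a * X ω) * g := fun g => by ring
    simp only [h2]
    rw [← ofReal_integral_eq_lintegral_ofReal (integrable_exp_mul_gaussianReal _)
      (Filter.Eventually.of_forall fun g => (Real.exp_pos _).le)]
    have h3 := congrFun (mgf_id_gaussianReal (μ := 0) (v := 1)) (a * X ω)
    simp only [mgf, id] at h3
    rw [h3, mul_pow, ha2]
    congr 2
    simp
    field_simp
    norm_num
  simp only [h1]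
  rw [lintegral_lintegral_swap (by fun_prop)]
  calc ∫⁻ g, ∫⁻ ω, ENNReal.ofReal (Real.exp (a * g * X ω)) ∂Pr ∂(gaussianReal 0 1)
      ≤ ∫⁻ g, ENNReal.ofReal (Real.exp (g ^ 2 / 4)) ∂(gaussianReal 0 1) := by
        refine lintegral_mono fun g => ?_
        rw [← ofReal_integral_eq_lintegral_ofReal (hX.integrable_exp_mul _)
          (Filter.Eventually.of_forall fun g => (Real.exp_pos _).le)]
        refine ENNReal.ofReal_le_ofReal ((hX.mgf_le (a * g)).trans (Real.exp_le_exp.2 (le_of_eq ?_)))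
        rw [mul_pow, ha2]
        field_simp
        ring
    _ = ∫⁻ g, ENNReal.ofReal (√2) * gaussianPDF 0 2 g := by
        rw [gaussianReal_of_var_ne_zero _ one_ne_zero,
          lintegral_withDensity_eq_lintegral_mul _ (measurable_gaussianPDF _ _) (by fun_prop)]
        refine lintegral_congr fun g => ?_
        simp only [Pi.mul_apply, gaussianPDF]
        rw [← ENNReal.ofReal_mul (gaussianPDFReal_nonneg _ _ _), ← ENNReal.ofReal_mul (by positivity)]
        congr 1
        simp only [gaussianPDFReal, NNReal.coe_one, NNReal.coe_ofNat, sub_zero]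
        rw [mul_assoc, ← Real.exp_add, ← mul_assoc]
        congr 1
        · rw [show 2 * Real.pi * 2 = 2 * (2 * Real.pi * 1) by ring,
            Real.sqrt_mul (by norm_num) (2 * Real.pi * 1)]
          field_simp
        · congr 1
          ring
    _ = ENNReal.ofReal (√2) := by
        rw [lintegral_const_mul _ (measurable_gaussianPDF _ _),
          lintegral_gaussianPDF_eq_one _ two_ne_zero, mul_one]
    _ ≤ 3 := by
        rw [show (3 : ℝ≥0∞) = ENNReal.ofReal 3 by simp]
        refine ENNReal.ofReal_le_ofReal (Real.sqrt_le_iff.2 ⟨by norm_num, by norm_num⟩)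

/-- Bernstein's bound on the moment generating function of a nonnegative variable with an
exponential moment. -/
lemma mgf_sub_integral_le [IsProbabilityMeasure Pr] {Y : Ω → ℝ} {τ θ : ℝ} (hτ : 0 < τ)
    (hYm : Measurable Y) (hY0 : ∀ ω, 0 ≤ Y ω)
    (hY : ∫⁻ ω, ENNReal.ofReal (Real.exp (τ * Y ω)) ∂Pr ≤ 3) (hθ : |θ| ≤ τ / 2) :
    Integrable (fun ω => Real.exp (θ * (Y ω - ∫ ω, Y ω ∂Pr))) Pr ∧
      mgf (fun ω => Y ω - ∫ ω, Y ω ∂Pr) Pr θ ≤ Real.exp (24 / τ ^ 2 * θ ^ 2) := by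
  have hint : Integrable (fun ω => Real.exp (τ * Y ω)) Pr := by
    refine ⟨by fun_prop, ?_⟩
    rw [hasFiniteIntegral_iff_ofReal (Filter.Eventually.of_forall fun ω => (Real.exp_pos _).le)]
    exact hY.trans_lt (by simp)
  have hval : ∫ ω, Real.exp (τ * Y ω) ∂Pr ≤ 3 := by
    rw [integral_eq_lintegral_of_nonneg_ae
      (Filter.Eventually.of_forall fun ω => (Real.exp_pos _).le) (by fun_prop)]
    exact ENNReal.toReal_le_of_le_ofReal (by norm_num) (by simpa using hY)
  have hYint : Integrable Y Pr := by
    refine Integrable.mono' (hint.const_mul (1 / τ)) hYm.aestronglyMeasurable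
      (Filter.Eventually.of_forall fun ω => ?_)
    rw [Real.norm_eq_abs, abs_of_nonneg (hY0 ω)]
    have := Real.add_one_le_exp (τ * Y ω)
    rw [div_mul_eq_mul_div, le_div_iff₀ hτ]
    linarith
  -- From `exp x ≤ 1 + x + x² exp |x|`. With `|θ| ≤ τ / 2`, half of the exponent `τ Y` absorbs `exp
  -- |θ Y|` and the other half absorbs `Y²`. The exponential moment `3` then turns `8` into `24`.
  have hptw : ∀ ω, Real.exp (θ * Y ω)
      ≤ 1 + θ * Y ω + 8 / τ ^ 2 * θ ^ 2 * Real.exp (τ * Y ω) := fun ω => by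
    have h1 : |Real.exp (θ * Y ω) - (1 + θ * Y ω)| ≤ (θ * Y ω) ^ 2 * Real.exp |θ * Y ω| := by
      have := Complex.norm_exp_sub_sum_le_norm_mul_exp ((θ * Y ω : ℝ) : ℂ) 2
      rw [Complex.norm_real] at this
      have h2 : Complex.exp ((θ * Y ω : ℝ) : ℂ) - ∑ m ∈ Finset.range 2,
          ((θ * Y ω : ℝ) : ℂ) ^ m / (m.factorial : ℂ)
          = ((Real.exp (θ * Y ω) - (1 + θ * Y ω) : ℝ) : ℂ) := by
        simp [Finset.sum_range_succ]
      rw [h2, Complex.norm_real, Real.norm_eq_abs, Real.norm_eq_abs, sq_abs] at this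
      exact this
    have h3 : |θ * Y ω| ≤ τ / 2 * Y ω := by
      rw [abs_mul, abs_of_nonneg (hY0 ω)]
      exact mul_le_mul_of_nonneg_right hθ (hY0 ω)
    have h4 : Y ω ^ 2 ≤ 8 / τ ^ 2 * Real.exp (τ / 2 * Y ω) := by
      have := Real.pow_div_factorial_le_exp (τ / 2 * Y ω)
        (mul_nonneg (by positivity) (hY0 ω)) 2
      rw [div_mul_eq_mul_div, le_div_iff₀ (by positivity)]
      simp only [Nat.factorial_two, Nat.cast_ofNat] at this
      nlinarith
    calc Real.exp (θ * Y ω)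
        ≤ 1 + θ * Y ω + (θ * Y ω) ^ 2 * Real.exp |θ * Y ω| := by
          linarith [(abs_le.1 h1).2]
      _ ≤ 1 + θ * Y ω + θ ^ 2 * (8 / τ ^ 2 * Real.exp (τ / 2 * Y ω)) * Real.exp (τ / 2 * Y ω) := by
          rw [mul_pow]
          gcongr
      _ = _ := by
          rw [show τ * Y ω = τ / 2 * Y ω + τ / 2 * Y ω by ring, Real.exp_add]
          ring
  have hlin : Integrable (fun ω => 1 + θ * Y ω) Pr :=
    (integrable_const _).add (hYint.const_mul _)
  have hbound : Integrable (fun ω => 1 + θ * Y ω + 8 / τ ^ 2 * θ ^ 2 * Real.exp (τ * Y ω)) Pr :=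
    hlin.add (hint.const_mul _)
  have hexp : Integrable (fun ω => Real.exp (θ * Y ω)) Pr :=
    Integrable.mono' hbound (by fun_prop) (Filter.Eventually.of_forall fun ω => by
      rw [Real.norm_eq_abs, abs_of_pos (Real.exp_pos _)]
      exact hptw ω)
  set m := ∫ ω, Y ω ∂Pr with hm
  have hsplit : ∀ ω, Real.exp (θ * (Y ω - m)) = Real.exp (-(θ * m)) * Real.exp (θ * Y ω) :=
    fun ω => by rw [← Real.exp_add]; congr 1; ring
  refine ⟨by simpa only [hsplit] using hexp.const_mul _, ?_⟩
  have h5 : ∫ ω, Real.exp (θ * Y ω) ∂Pr ≤ Real.exp (θ * m + 24 / τ ^ 2 * θ ^ 2) := by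
    calc ∫ ω, Real.exp (θ * Y ω) ∂Pr
        ≤ ∫ ω, (1 + θ * Y ω + 8 / τ ^ 2 * θ ^ 2 * Real.exp (τ * Y ω)) ∂Pr :=
          integral_mono hexp hbound hptw
      _ = 1 + θ * m + 8 / τ ^ 2 * θ ^ 2 * ∫ ω, Real.exp (τ * Y ω) ∂Pr := by
          rw [integral_add hlin (hint.const_mul _),
            integral_add (integrable_const _) (hYint.const_mul _), integral_const_mul,
            integral_const_mul]
          simp [hm]
      _ ≤ 1 + θ * m + 8 / τ ^ 2 * θ ^ 2 * 3 := by gcongr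
      _ = θ * m + 24 / τ ^ 2 * θ ^ 2 + 1 := by ring
      _ ≤ _ := Real.add_one_le_exp _
  simp only [mgf, hsplit]
  rw [integral_const_mul]
  calc Real.exp (-(θ * m)) * ∫ ω, Real.exp (θ * Y ω) ∂Pr
      ≤ Real.exp (-(θ * m)) * Real.exp (θ * m + 24 / τ ^ 2 * θ ^ 2) := by gcongr
    _ = _ := by rw [← Real.exp_add]; congr 1; ring

variable {ι : Type*} {s : Finset ι} {M : ℕ} {u : ℝ}

/-- Chernoff's bound for sums of at most `M` independent variables. -/
lemma measure_abs_sum_ge_le [IsProbabilityMeasure Pr] {Z : ι → Ω → ℝ} (hind : iIndepFun Z Pr)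
    (hZm : ∀ i, Measurable (Z i)) (hs : s.card ≤ M) {B θ t : ℝ} (hB : 0 ≤ B) (hθ : 0 ≤ θ)
    (hZ : ∀ i, ∀ θ', |θ'| = θ → Integrable (fun ω => Real.exp (θ' * Z i ω)) Pr ∧
      mgf (Z i) Pr θ' ≤ Real.exp (B * θ ^ 2)) :
    Pr.real {ω | t ≤ |∑ i ∈ s, Z i ω|} ≤ 2 * Real.exp (-(θ * t) + M * (B * θ ^ 2)) := by
  have hmgf : ∀ θ', |θ'| = θ → mgf (∑ i ∈ s, Z i) Pr θ' ≤ Real.exp (M * (B * θ ^ 2)) :=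
    fun θ' hθ' => by
      rw [hind.mgf_sum hZm]
      calc ∏ i ∈ s, mgf (Z i) Pr θ' ≤ ∏ i ∈ s, Real.exp (B * θ ^ 2) :=
            Finset.prod_le_prod (fun i _ => mgf_nonneg) fun i _ => (hZ i θ' hθ').2
        _ = Real.exp (s.card * (B * θ ^ 2)) := by
            rw [Finset.prod_const, ← Real.exp_nat_mul]
        _ ≤ _ := by gcongr
  have hint : ∀ θ', |θ'| = θ → Integrable (fun ω => Real.exp (θ' * (∑ i ∈ s, Z i) ω)) Pr :=
    fun θ' hθ' => hind.integrable_exp_mul_sum hZm fun i _ => (hZ i θ' hθ').1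
  have h1 : Pr.real {ω | t ≤ (∑ i ∈ s, Z i) ω} ≤ Real.exp (-(θ * t) + M * (B * θ ^ 2)) := by
    refine (measure_ge_le_exp_mul_mgf t hθ (hint θ (abs_of_nonneg hθ))).trans ?_
    rw [Real.exp_add, neg_mul]
    gcongr
    exact hmgf θ (abs_of_nonneg hθ)
  have h2 : Pr.real {ω | (∑ i ∈ s, Z i) ω ≤ -t} ≤ Real.exp (-(θ * t) + M * (B * θ ^ 2)) := by
    have ha : |-θ| = θ := by rw [abs_neg, abs_of_nonneg hθ]
    refine (measure_le_le_exp_mul_mgf (-t) (neg_nonpos.2 hθ) (hint (-θ) ha)).trans ?_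
    rw [Real.exp_add, show - -θ * -t = -(θ * t) by ring]
    gcongr
    exact hmgf (-θ) ha
  calc Pr.real {ω | t ≤ |∑ i ∈ s, Z i ω|}
      ≤ Pr.real ({ω | t ≤ (∑ i ∈ s, Z i) ω} ∪ {ω | (∑ i ∈ s, Z i) ω ≤ -t}) := by
        refine measureReal_mono fun ω hω => ?_
        simp only [Set.mem_ofPred_eq, Set.mem_union, Finset.sum_apply] at hω ⊢
        rcases le_abs.1 hω with h | h
        · exact Or.inl h
        · exact Or.inr (by linarith)
    _ ≤ _ := measureReal_union_le _ _
    _ ≤ _ := by linarith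

/-- Bernstein's regime: with `τ = 1 / (4 c)` the centred squares satisfy the mgf bound with `24 / τ²
= 384 c²`. The optimal `θ = u / (8 c)` is admissible exactly because `u ≤ 1`, and the exponent is
`-12 M u² + 6 M u²`. -/
lemma measure_abs_sum_sq_sub_ge_le [IsProbabilityMeasure Pr] {X : ι → Ω → ℝ} {c : ℝ≥0}
    (hind : iIndepFun X Pr) (hXm : ∀ i, Measurable (X i)) (hs : s.card ≤ M) (hc : 0 < c)
    (hX : ∀ i, HasSubgaussianMGF (X i) c Pr) (hu : 0 ≤ u) (hu1 : u ≤ 1) :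
    Pr.real {ω | 96 * c * u * M ≤ |∑ i ∈ s, (X i ω ^ 2 - ∫ ω, X i ω ^ 2 ∂Pr)|}
      ≤ 2 * Real.exp (-(6 * M * u ^ 2)) := by
  have hc' : (0 : ℝ) < c := hc
  have hind' : iIndepFun (fun i ω => X i ω ^ 2 - ∫ ω, X i ω ^ 2 ∂Pr) Pr :=
    hind.comp (fun i x => x ^ 2 - ∫ ω, X i ω ^ 2 ∂Pr) fun i => by fun_prop
  have h := measure_abs_sum_ge_le (t := 96 * c * u * M) hind'
    (fun i => ((hXm i).pow_const 2).sub_const _) hs (B := 384 * c ^ 2) (θ := u / (8 * c))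
    (by positivity) (by positivity) (fun i θ' hθ' => by
      have h1 := mgf_sub_integral_le (Pr := Pr) (Y := fun ω => X i ω ^ 2) (τ := 1 / (4 * c))
        (θ := θ') (by positivity) ((hXm i).pow_const 2) (fun ω => sq_nonneg _)
        (by
          convert lintegral_exp_sq_div_le hc (hXm i) (hX i) using 5
          ring)
        (by
          rw [hθ', div_div, div_le_div_iff₀ (by positivity) (by positivity)]
          nlinarith)
      refine ⟨h1.1, h1.2.trans (Real.exp_le_exp.2 (le_of_eq ?_))⟩
      rw [← sq_abs θ', hθ']
      field_simp
      ring)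
  refine h.trans (le_of_eq ?_)
  congr 2
  field_simp
  ring

/-- Chernoff's bound at the optimal `θ = 2 u / √c`, with exponent `-4 M u² + 2 M u²`. -/
lemma measure_abs_sum_ge_le_of_hasSubgaussianMGF [IsProbabilityMeasure Pr] {X : ι → Ω → ℝ}
    {c : ℝ≥0} (hind : iIndepFun X Pr) (hXm : ∀ i, Measurable (X i)) (hs : s.card ≤ M) (hc : 0 < c)
    (hX : ∀ i, HasSubgaussianMGF (X i) c Pr) (hu : 0 ≤ u) :
    Pr.real {ω | 2 * √c * u * M ≤ |∑ i ∈ s, X i ω|} ≤ 2 * Real.exp (-(2 * M * u ^ 2)) := by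
  have hc' : (0 : ℝ) < c := hc
  have hsc : √(c : ℝ) ^ 2 = c := Real.sq_sqrt hc'.le
  have h := measure_abs_sum_ge_le (t := 2 * √c * u * M) hind hXm hs (B := c / 2)
    (θ := 2 * u / √c) (by positivity) (by positivity) (fun i θ' hθ' => by
      refine ⟨(hX i).integrable_exp_mul θ', ((hX i).mgf_le θ').trans
        (Real.exp_le_exp.2 (le_of_eq ?_))⟩
      rw [← sq_abs θ', hθ']
      ring)
  refine h.trans (le_of_eq ?_)
  congr 2
  have hsp : 0 < √(c : ℝ) := Real.sqrt_pos.2 hc'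
  rw [div_pow, hsc]
  field_simp
  ring

end Tail

end SGMM

namespace SGMM

/-! ### One-dimensional marginals and second moments of sub-gaussian laws. -/

section SecondMoment

variable {d : ℕ} {D : Measure (E d)} {a : E d} {ψ : ℝ}

/-- The radius `ρ` gives all directions of a bounded net one common parameter. -/
lemma IsSubGaussian.hasSubgaussianMGF (h : IsSubGaussian D a ψ) {v : E d} {ρ : ℝ}
    (hv : ‖v‖ ≤ ρ) :
    HasSubgaussianMGF (fun x => inner ℝ v (x - a)) (Real.toNNReal ((ρ * ψ) ^ 2)) D where
  integrable_exp_mul t := by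
    have := h.integrable_exp (t • v)
    simpa only [real_inner_smul_left] using this
  mgf_le t := by
    have h1 := h.mgf_le (t • v)
    simp only [real_inner_smul_left] at h1
    refine h1.trans (Real.exp_le_exp.2 ?_)
    rw [Real.coe_toNNReal _ (sq_nonneg _), norm_smul, mul_pow, Real.norm_eq_abs, sq_abs, mul_pow]
    have : ‖v‖ ^ 2 ≤ ρ ^ 2 := by gcongr
    have h2 : 0 ≤ t ^ 2 * ψ ^ 2 := by positivity
    nlinarith

lemma IsSubGaussian.integrable_inner_mul_inner (h : IsSubGaussian D a ψ) (x y : E d) :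
    Integrable (fun z => inner ℝ x (z - a) * inner ℝ y (z - a)) D := by
  have h2 : ∀ v : E d, MemLp (fun z => inner ℝ v (z - a)) 2 D := fun v => by
    simpa using (h.hasSubgaussianMGF (v := v) le_rfl).memLp 2
  exact (h2 x).integrable_mul (h2 y)

lemma IsSubGaussian.dotProduct_secondMoment_mulVec (h : IsSubGaussian D a ψ) (x y : E d) :
    y.ofLp ⬝ᵥ (secondMoment D a *ᵥ x.ofLp) = ∫ z, inner ℝ y (z - a) * inner ℝ x (z - a) ∂D := by
  have hc : ∀ i j, Integrable (fun z : E d => (z i - a i) * (z j - a j)) D := fun i j => by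
    simpa [PiLp.inner_apply] using
      h.integrable_inner_mul_inner (EuclideanSpace.single i 1) (EuclideanSpace.single j 1)
  have h1 : ∀ z : E d, inner ℝ y (z - a) * inner ℝ x (z - a)
      = ∑ i, ∑ j, y i * x j * ((z i - a i) * (z j - a j)) := fun z => by
    simp only [PiLp.inner_apply, Finset.sum_mul_sum, RCLike.inner_apply, conj_trivial,
      PiLp.sub_apply]
    exact Finset.sum_congr rfl fun i _ => Finset.sum_congr rfl fun j _ => by ring
  simp only [h1]
  rw [integral_finsetSum _ fun i _ => integrable_finsetSum _ fun j _ => (hc i j).const_mul _]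
  simp only [dotProduct, Matrix.mulVec, secondMoment, Matrix.of_apply]
  refine Finset.sum_congr rfl fun i _ => ?_
  rw [integral_finsetSum _ fun j _ => (hc i j).const_mul _, Finset.mul_sum]
  refine Finset.sum_congr rfl fun j _ => ?_
  rw [integral_const_mul]
  ring

lemma isHermitian_secondMoment (D : Measure (E d)) (a : E d) :
    (secondMoment D a).IsHermitian := by
  ext i j
  simp [secondMoment, mul_comm]

end SecondMoment

/-! ### Discretisation of the unit ball. -/

section Net

/-- A `1/4`-net of the unit ball, made of points of a grid. -/
lemma exists_net (d : ℕ) (hd : 0 < d) : ∃ 𝒩 : Finset (E d), 𝒩.card ≤ (9 * d) ^ d ∧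
    (∀ v ∈ 𝒩, ‖v‖ ≤ 2) ∧ ∀ x : E d, ‖x‖ ≤ 1 → ∃ v ∈ 𝒩, ‖x - v‖ ≤ 1 / 4 := by
  classical
  have hd' : (0 : ℝ) < d := by exact_mod_cast hd
  -- The grid of mesh `1 / (4 d)` in `[-1, 1]^d`. Rounding down moves each coordinate by at most the
  -- mesh, hence the point by at most `1 / (4 √d) ≤ 1 / 4`.
  let g : (Fin d → Fin (8 * d + 1)) → E d := fun k =>
    WithLp.toLp 2 fun i => ((k i : ℕ) - 4 * d : ℝ) / (4 * d)
  refine ⟨(Finset.univ.image g).filter fun v => ‖v‖ ≤ 2, ?_, ?_, ?_⟩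
  · refine (Finset.card_filter_le _ _).trans (Finset.card_image_le.trans ?_)
    rw [Finset.card_univ, Fintype.card_fun, Fintype.card_fin, Fintype.card_fin]
    exact Nat.pow_le_pow_left (by omega) d
  · exact fun v hv => (Finset.mem_filter.1 hv).2
  · intro x hx
    have hxi : ∀ i, |x i| ≤ 1 := fun i => by
      have := (PiLp.norm_apply_le x i).trans hx
      rwa [Real.norm_eq_abs] at this
    have hk0 : ∀ i, 0 ≤ 4 * d * x i + 4 * d := fun i => by nlinarith [(abs_le.1 (hxi i)).1]
    have hk : ∀ i, ⌊4 * d * x i + 4 * d⌋₊ < 8 * d + 1 := fun i => by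
      rw [Nat.lt_succ_iff]
      refine Nat.floor_le_of_le ?_
      push_cast
      nlinarith [(abs_le.1 (hxi i)).2]
    let k : Fin d → Fin (8 * d + 1) := fun i => ⟨_, hk i⟩
    have hdist : ‖x - g k‖ ≤ 1 / 4 := by
      refine le_of_sq_le_sq ?_ (by norm_num)
      rw [EuclideanSpace.norm_sq_eq]
      have hcoord : ∀ i, ‖(x - g k) i‖ ^ 2 ≤ (1 / (4 * d : ℝ)) ^ 2 := fun i => by
        have e : (x - g k) i
            = (4 * d * x i + 4 * d - ⌊4 * d * x i + 4 * d⌋₊) / (4 * d) := by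
          simp only [g, k, PiLp.sub_apply]
          field_simp
          ring
        have h1 := Nat.floor_le (hk0 i)
        have h2 := Nat.lt_floor_add_one (4 * d * x i + 4 * d)
        have h3 : 0 ≤ (4 * d * x i + 4 * d - ⌊4 * d * x i + 4 * d⌋₊) / (4 * d : ℝ) :=
          div_nonneg (by linarith) (by positivity)
        rw [e, Real.norm_eq_abs, abs_of_nonneg h3]
        refine pow_le_pow_left₀ h3 (div_le_div_of_nonneg_right ?_ (by positivity)) 2
        linarith
      calc ∑ i, ‖(x - g k) i‖ ^ 2 ≤ ∑ _i : Fin d, (1 / (4 * d : ℝ)) ^ 2 :=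
            Finset.sum_le_sum fun i _ => hcoord i
        _ = 1 / (16 * d) := by
            rw [Finset.sum_const, Finset.card_univ, Fintype.card_fin, nsmul_eq_mul]
            field_simp
            norm_num
        _ ≤ (1 / 4) ^ 2 := by
            rw [div_le_iff₀ (by positivity)]
            have : (1 : ℝ) ≤ d := by exact_mod_cast hd
            nlinarith
    refine ⟨g k, Finset.mem_filter.2 ⟨Finset.mem_image_of_mem _ (Finset.mem_univ _), ?_⟩, hdist⟩
    have := norm_le_norm_add_norm_sub' (g k) x
    rw [norm_sub_rev] at this
    linarith

/-- The quadratic form of a symmetric operator is controlled by its values on a net. -/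
lemma abs_inner_le_of_net {d : ℕ} {T : E d →ₗ[ℝ] E d} (hT : T.IsSymmetric) {𝒩 : Finset (E d)}
    (hnet : ∀ x : E d, ‖x‖ ≤ 1 → ∃ v ∈ 𝒩, ‖x - v‖ ≤ 1 / 4) {b : ℝ}
    (hb : ∀ v ∈ 𝒩, |inner ℝ (T v) v| ≤ b) (x : E d) :
    |inner ℝ (T x) x| ≤ 3 * b * ‖x‖ ^ 2 := by
  have hcont : Continuous fun x : E d => |inner ℝ (T x) x| :=
    ((LinearMap.continuous_of_finiteDimensional T).inner continuous_id).abs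
  obtain ⟨u, hu, hmax⟩ := (isCompact_closedBall (0 : E d) 1).exists_isMaxOn
    ⟨0, by simp⟩ hcont.continuousOn
  rw [mem_closedBall_zero_iff] at hu
  set S := |inner ℝ (T u) u| with hS
  have hform : ∀ z : E d, |inner ℝ (T z) z| ≤ S * ‖z‖ ^ 2 := fun z => by
    rcases eq_or_ne z 0 with rfl | hz
    · simp
    have hz' : 0 < ‖z‖ := norm_pos_iff.2 hz
    have h1 : |inner ℝ (T (‖z‖⁻¹ • z)) (‖z‖⁻¹ • z)| ≤ S :=
      hmax (mem_closedBall_zero_iff.2 (by simp [norm_smul, hz]))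
    rw [map_smul, real_inner_smul_left, real_inner_smul_right, ← mul_assoc, abs_mul,
      abs_of_nonneg (by positivity), ← mul_inv, inv_mul_le_iff₀ (by positivity)] at h1
    linarith
  obtain ⟨v, hv, huv⟩ := hnet u hu
  have h1 : |inner ℝ (T (u - v)) (u + v)| ≤ S * ‖u - v‖ * ‖u + v‖ :=
    abs_inner_le_of_abs_quadratic_le hT ⊤ (fun z _ => hform z) Submodule.mem_top Submodule.mem_top
  have h2 : inner ℝ (T (u - v)) (u + v) = inner ℝ (T u) u - inner ℝ (T v) v := by
    have : inner ℝ (T v) u = inner ℝ (T u) v := by rw [hT v u, real_inner_comm]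
    simp only [map_sub, inner_sub_left, inner_add_right, this]
    ring
  have h3 : ‖u + v‖ ≤ 9 / 4 := by
    have : u + v = (2 : ℝ) • u - (u - v) := by rw [two_smul]; abel
    rw [this]
    refine (norm_sub_le _ _).trans ?_
    rw [norm_smul, Real.norm_two]
    linarith
  have hS0 : 0 ≤ S := abs_nonneg _
  have h4 : S * ‖u - v‖ * ‖u + v‖ ≤ S * (1 / 4) * (9 / 4) := by gcongr
  -- The maximum `S` over the ball reappears on the right and is absorbed: `S ≤ 16 b / 7 ≤ 3 b`.
  have h5 : S ≤ b + S * (9 / 16) := by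
    have h6 : |inner ℝ (T u) u| ≤ |inner ℝ (T v) v| + |inner ℝ (T u) u - inner ℝ (T v) v| := by
      have := abs_add_le (inner ℝ (T v) v) (inner ℝ (T u) u - inner ℝ (T v) v)
      rwa [add_sub_cancel] at this
    have := hb v hv
    rw [← h2] at h6
    linarith
  refine (hform x).trans ?_
  gcongr
  linarith

end Net

/-! ### Uniform concentration of the first two empirical moments of the inliers. -/

section Concentration

variable {Ω : Type*} [MeasurableSpace Ω] {Pr : Measure Ω}
  {ι : Type*} {d M : ℕ} {D : Measure (E d)} {K : ℝ} {X : ι → Ω → E d}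

lemma integral_inner_sq_eq (hXm : ∀ i, Measurable (X i)) (hXD : ∀ i, Pr.map (X i) = D) (i : ι)
    (v : E d) : ∫ ω, inner ℝ v (X i ω) ^ 2 ∂Pr = ∫ z, inner ℝ v z ^ 2 ∂D := by
  rw [← hXD i, integral_map (hXm i).aemeasurable (by fun_prop)]

lemma hasSubgaussianMGF_inner (hD : IsSubGaussian D 0 K) (hXm : ∀ i, Measurable (X i))
    (hXD : ∀ i, Pr.map (X i) = D) (i : ι) {v : E d} {ρ : ℝ} (hv : ‖v‖ ≤ ρ) :
    HasSubgaussianMGF (fun ω => inner ℝ v (X i ω)) (Real.toNNReal ((ρ * K) ^ 2)) Pr := by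
  have h1 := hD.hasSubgaussianMGF hv
  rw [← hXD i] at h1
  simpa [Function.comp_def] using HasSubgaussianMGF.of_map (hXm i).aemeasurable h1

/-- Simultaneous concentration of the sum and of the second moments of an independent sample
of at most `M` vectors, outside of a measurable set of samples. -/
theorem exists_measurableSet_concentration [IsProbabilityMeasure Pr] (hind : iIndepFun X Pr) (hXm : ∀ i, Measurable (X i))
    (hXD : ∀ i, Pr.map (X i) = D) (hD : IsSubGaussian D 0 K) (s : Finset ι) (hs : s.card ≤ M)
    (hd : 0 < d) (hdM : d ≤ M) (hM : 2 ≤ M) {u : ℝ} (hu : 0 ≤ u) (hu1 : u ≤ 1)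
    (huM : M * u ^ 2 = d * Real.log M) :
    ∃ B : Set (ι → E d), MeasurableSet B ∧
      Pr.real {ω | (fun i => X i ω) ∈ B} ≤ 4 / M ∧
      ∀ z ∉ B, (∀ x : E d, |∑ i ∈ s, (inner ℝ x (z i) ^ 2 - ∫ z, inner ℝ x z ^ 2 ∂D)|
          ≤ 1152 * K ^ 2 * u * M * ‖x‖ ^ 2) ∧
        ‖∑ i ∈ s, z i‖ ^ 2 ≤ 4 * K ^ 2 * u ^ 2 * M ^ 2 := by
  classical
  obtain ⟨𝒩, hcard, h𝒩2, hnet⟩ := exists_net d hd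
  have hK := hD.pos
  have hM0 : (0 : ℝ) < M := by exact_mod_cast (by omega : 0 < M)
  have hd0 : (0 : ℝ) < d := by exact_mod_cast hd
  have hM2 : (2 : ℝ) ≤ M := by exact_mod_cast hM
  have hL : 0 ≤ Real.log M := Real.log_nonneg (by linarith)
  -- The sum is handled coordinate by coordinate at the dimension-free scale `u'`; adding up `d`
  -- squares restores `u`.
  set u' : ℝ := √(Real.log M / M) with hu'
  have hu'2 : u' ^ 2 = Real.log M / M := Real.sq_sqrt (by positivity)
  have hdu : d * u' ^ 2 = u ^ 2 := by
    rw [hu'2]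
    field_simp
    linarith
  let B₁ : E d → Set (ι → E d) := fun v => {z | 96 * ((2 * K) ^ 2) * u * M
    ≤ |∑ i ∈ s, (inner ℝ v (z i) ^ 2 - ∫ z, inner ℝ v z ^ 2 ∂D)|}
  let B₂ : Fin d → Set (ι → E d) := fun j => {z | 2 * K * u' * M ≤ |∑ i ∈ s, z i j|}
  have hB₁ : ∀ v, MeasurableSet (B₁ v) := fun v =>
    measurableSet_le measurable_const (by fun_prop)
  have hB₂ : ∀ j, MeasurableSet (B₂ j) := fun j =>
    measurableSet_le measurable_const (by fun_prop)
  refine ⟨(⋃ v ∈ 𝒩, B₁ v) ∪ ⋃ j, B₂ j, (Finset.measurableSet_biUnion _ fun v _ => hB₁ v).union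
    (MeasurableSet.iUnion hB₂), ?_, ?_⟩
  · have hind' : ∀ v : E d, iIndepFun (fun i ω => inner ℝ v (X i ω)) Pr := fun v =>
      hind.comp (fun _ x => inner ℝ v x) fun _ => by fun_prop
    have hm' : ∀ (v : E d) i, Measurable fun ω => inner ℝ v (X i ω) := fun v i => by
      have := hXm i
      fun_prop
    have hexp : ∀ k : ℕ, Real.exp (-(k * Real.log M)) = ((M : ℝ) ^ k)⁻¹ := fun k => by
      rw [Real.exp_neg, Real.exp_nat_mul, Real.exp_log hM0]
    have h1 : ∀ v ∈ 𝒩, Pr.real {ω | (fun i => X i ω) ∈ B₁ v} ≤ 2 * ((M : ℝ) ^ (6 * d))⁻¹ := by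
      intro v hv
      have h := measure_abs_sum_sq_sub_ge_le (hind' v) (hm' v) hs
        (Real.toNNReal_pos.2 (by positivity))
        (fun i => hasSubgaussianMGF_inner hD hXm hXD i (h𝒩2 v hv)) hu hu1
      simp only [integral_inner_sq_eq hXm hXD, Real.coe_toNNReal _ (sq_nonneg (2 * K))] at h
      refine h.trans (le_of_eq ?_)
      rw [← hexp]
      push_cast
      congr 3
      linear_combination 6 * huM
    have h2 : ∀ j, Pr.real {ω | (fun i => X i ω) ∈ B₂ j} ≤ 2 * ((M : ℝ) ^ 2)⁻¹ := by
      intro j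
      have hj : ∀ z : E d, inner ℝ (EuclideanSpace.single j (1 : ℝ)) z = z j := fun z => by
        simp [PiLp.inner_apply]
      have h := measure_abs_sum_ge_le_of_hasSubgaussianMGF
        (hind' (EuclideanSpace.single j 1)) (hm' _) hs
        (Real.toNNReal_pos.2 (by positivity))
        (fun i => hasSubgaussianMGF_inner hD hXm hXD i (ρ := 1) (by simp))
        (Real.sqrt_nonneg (Real.log M / M))
      simp only [hj, one_mul, Real.coe_toNNReal _ (sq_nonneg K), Real.sqrt_sq hK.le] at h
      refine h.trans (le_of_eq ?_)
      rw [← hexp, ← hu', hu'2]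
      congr 3
      push_cast
      field_simp
    have h3 : {ω | (fun i => X i ω) ∈ (⋃ v ∈ 𝒩, B₁ v) ∪ ⋃ j, B₂ j}
        = (⋃ v ∈ 𝒩, {ω | (fun i => X i ω) ∈ B₁ v}) ∪ ⋃ j, {ω | (fun i => X i ω) ∈ B₂ j} := by
      ext ω
      simp
    rw [h3]
    refine (measureReal_union_le _ _).trans ?_
    have h4 : Pr.real (⋃ v ∈ 𝒩, {ω | (fun i => X i ω) ∈ B₁ v}) ≤ 2 / M := by
      refine (measureReal_biUnion_finset_le _ _).trans ((Finset.sum_le_sum h1).trans ?_)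
      rw [Finset.sum_const, nsmul_eq_mul]
      have h5 : (𝒩.card : ℝ) ≤ (9 * M) ^ d := by
        calc (𝒩.card : ℝ) ≤ (((9 * d) ^ d : ℕ) : ℝ) := by exact_mod_cast hcard
          _ ≤ (9 * M) ^ d := by
            push_cast
            have : (d : ℝ) ≤ M := by exact_mod_cast hdM
            gcongr
      -- The tail at scale `u` is of order `M ^ (-6 d)`, small enough to beat the net, whose size is
      -- at most `(9 M) ^ d` since `d ≤ M`.
      have h6 : ((9 * M : ℝ)) ^ d * ((M : ℝ) ^ (6 * d))⁻¹ ≤ 1 / M := by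
        rw [pow_mul, ← inv_pow, ← mul_pow]
        have h7 : 9 * (M : ℝ) * ((M : ℝ) ^ 6)⁻¹ ≤ 1 / M := by
          rw [← div_eq_mul_inv, div_le_div_iff₀ (by positivity) hM0]
          have : (16 : ℝ) ≤ M ^ 4 := by
            calc (16 : ℝ) = 2 ^ 4 := by norm_num
              _ ≤ M ^ 4 := by gcongr
          nlinarith [mul_pos hM0 hM0]
        have h8 : (1 : ℝ) / M ≤ 1 := by
          rw [div_le_one hM0]
          linarith
        calc (9 * (M : ℝ) * ((M : ℝ) ^ 6)⁻¹) ^ d ≤ (1 / M) ^ d := by gcongr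
          _ ≤ (1 / M) ^ 1 := pow_le_pow_of_le_one (by positivity) h8 hd
          _ = 1 / M := pow_one _
      calc (𝒩.card : ℝ) * (2 * ((M : ℝ) ^ (6 * d))⁻¹)
          ≤ (9 * M) ^ d * (2 * ((M : ℝ) ^ (6 * d))⁻¹) := by gcongr
        _ = 2 * ((9 * M : ℝ) ^ d * ((M : ℝ) ^ (6 * d))⁻¹) := by ring
        _ ≤ 2 * (1 / M) := by gcongr
        _ = 2 / M := by ring
    have h5 : Pr.real (⋃ j, {ω | (fun i => X i ω) ∈ B₂ j}) ≤ 2 / M := by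
      refine (measureReal_iUnion_fintype_le _).trans
        ((Finset.sum_le_sum fun j _ => h2 j).trans ?_)
      rw [Finset.sum_const, nsmul_eq_mul, Finset.card_univ, Fintype.card_fin]
      have : (d : ℝ) ≤ M := by exact_mod_cast hdM
      calc (d : ℝ) * (2 * ((M : ℝ) ^ 2)⁻¹) ≤ M * (2 * ((M : ℝ) ^ 2)⁻¹) := by gcongr
        _ = 2 / M := by field_simp
    calc _ ≤ 2 / (M : ℝ) + 2 / M := add_le_add h4 h5
      _ = 4 / M := by ring
  · intro z hz
    simp only [Set.mem_union, Set.mem_iUnion, not_or, not_exists] at hz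
    obtain ⟨hz1, hz2⟩ := hz
    constructor
    · intro x
      let A : Matrix (Fin d) (Fin d) ℝ :=
        ∑ i ∈ s, (Matrix.vecMulVec (z i).ofLp (z i).ofLp - secondMoment D 0)
      have hA : A.IsHermitian := by
        have h1 := isHermitian_secondMoment D (0 : E d)
        ext i j
        have h2 := congrFun (congrFun h1 i) j
        rw [Matrix.conjTranspose_apply, star_trivial] at h2 ⊢
        simp only [A, Matrix.sum_apply, Matrix.sub_apply, Matrix.vecMulVec_apply, mul_comm, h2]
      have hAx : ∀ x : E d, inner ℝ (Matrix.toEuclideanLin A x) x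
          = ∑ i ∈ s, (inner ℝ x (z i) ^ 2 - ∫ z, inner ℝ x z ^ 2 ∂D) := fun x => by
        refine (inner_toLp_mulVec A x x).trans ?_
        rw [Matrix.sum_mulVec, dotProduct_sum]
        refine Finset.sum_congr rfl fun i _ => ?_
        rw [Matrix.sub_mulVec, dotProduct_sub, dotProduct_vecMulVec_mulVec,
          hD.dotProduct_secondMoment_mulVec, real_inner_comm]
        simp only [sub_zero, sq]
      have h := abs_inner_le_of_net (Matrix.isSymmetric_toEuclideanLin_iff.2 hA) hnet
        (b := 96 * (2 * K) ^ 2 * u * M) (fun v hv => by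
          rw [hAx]
          exact (not_le.1 (hz1 v hv)).le) x
      rw [hAx] at h
      refine h.trans (le_of_eq ?_)
      ring
    · rw [EuclideanSpace.norm_sq_eq]
      calc ∑ j, ‖(∑ i ∈ s, z i) j‖ ^ 2 ≤ ∑ _j : Fin d, (2 * K * u' * M) ^ 2 := by
            refine Finset.sum_le_sum fun j _ => ?_
            have h1 : |∑ i ∈ s, z i j| ≤ 2 * K * u' * M := (not_le.1 (hz2 j)).le
            rw [Real.norm_eq_abs, WithLp.ofLp_sum, Finset.sum_apply]
            gcongr
        _ = 4 * K ^ 2 * u ^ 2 * M ^ 2 := by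
            rw [Finset.sum_const, nsmul_eq_mul, Finset.card_univ, Fintype.card_fin, ← hdu]
            ring

end Concentration

end SGMM

namespace SGMM

/-! ### Second moments of the mixture compared with the matrix of means. -/

section Mixture

variable {d r : ℕ} {w : Fin r → ℝ} {D : Fin r → Measure (E d)} {μ : Fin r → E d} {ψ : Fin r → ℝ}

lemma isProbabilityMeasure_labelledMixture [∀ k, IsProbabilityMeasure (D k)]
    (hw : ∀ k, 0 < w k) (hw1 : ∑ k, w k = 1) : IsProbabilityMeasure (labelledMixture w D) := by
  constructor
  simp only [labelledMixture, Measure.finsetSum_apply, Measure.smul_apply, measure_univ,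
    smul_eq_mul, mul_one]
  rw [← ENNReal.ofReal_sum_of_nonneg fun k _ => (hw k).le, hw1, ENNReal.ofReal_one]

lemma map_snd_labelledMixture [∀ k, IsProbabilityMeasure (D k)] :
    (labelledMixture w D).map Prod.snd = ∑ k, ENNReal.ofReal (w k) • D k := by
  rw [labelledMixture, Measure.map_finset_sum measurable_snd.aemeasurable]
  refine Finset.sum_congr rfl fun k _ => ?_
  rw [Measure.map_smul, Measure.map_snd_prod, measure_univ, one_smul]

lemma integral_map_snd_labelledMixture [∀ k, IsProbabilityMeasure (D k)] (hw : ∀ k, 0 < w k)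
    {f : E d → ℝ} (hf : ∀ k, Integrable f (D k)) :
    ∫ z, f z ∂((labelledMixture w D).map Prod.snd) = ∑ k, w k * ∫ z, f z ∂(D k) := by
  rw [map_snd_labelledMixture,
    integral_finsetSum_measure fun k _ => (hf k).smul_measure ENNReal.ofReal_ne_top]
  refine Finset.sum_congr rfl fun k _ => ?_
  rw [integral_smul_measure, ENNReal.toReal_ofReal (hw k).le, smul_eq_mul]

lemma IsSubGaussian.integral_inner_sq {D : Measure (E d)} [IsProbabilityMeasure D] {a : E d}
    {ψ : ℝ} (h : IsSubGaussian D a ψ) (x : E d) :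
    Integrable (fun z => inner ℝ x z ^ 2) D ∧
      ∫ z, inner ℝ x z ^ 2 ∂D = inner ℝ a x ^ 2 + ∫ z, inner ℝ x (z - a) ^ 2 ∂D := by
  have h1 : Integrable (fun z => inner ℝ x (z - a) ^ 2) D := by
    simpa only [sq] using h.integrable_inner_mul_inner x x
  have h2 : Integrable (fun z => inner ℝ x z) D := h.integrable.const_inner x
  have h3 : ∀ z, inner ℝ x z ^ 2
      = inner ℝ x (z - a) ^ 2 + (2 * inner ℝ x a * inner ℝ x z - inner ℝ x a ^ 2) := fun z => by
    rw [inner_sub_right]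
    ring
  have h4 : Integrable (fun z => 2 * inner ℝ x a * inner ℝ x z - inner ℝ x a ^ 2) D :=
    (h2.const_mul _).sub (integrable_const _)
  rw [funext h3]
  refine ⟨h1.add h4, ?_⟩
  have h5 : ∫ z, inner ℝ x z ∂D = inner ℝ x a := by
    rw [integral_inner h.integrable, h.mean]
  rw [integral_add h1 h4, integral_sub (h2.const_mul _) (integrable_const _), integral_const_mul,
    h5, real_inner_comm a x]
  simp
  ring

/-- The second moments of the mixture in terms of its centres and its noise. -/
lemma mixture_second_moment_bounds [∀ k, IsProbabilityMeasure (D k)] (hw : ∀ k, 0 < w k)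
    (hw1 : ∑ k, w k = 1) (hD : ∀ k, IsSubGaussian (D k) (μ k) (ψ k)) (x : E d) :
    ∑ k, w k * inner ℝ (μ k) x ^ 2 ≤ ∫ z, inner ℝ x z ^ 2 ∂((labelledMixture w D).map Prod.snd) ∧
    ∫ z, inner ℝ x z ^ 2 ∂((labelledMixture w D).map Prod.snd)
      ≤ ∑ k, w k * inner ℝ (μ k) x ^ 2 + sigmaMax D μ ^ 2 * ‖x‖ ^ 2 := by
  rw [integral_map_snd_labelledMixture hw fun k => ((hD k).integral_inner_sq x).1]
  constructor
  · refine Finset.sum_le_sum fun k _ => ?_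
    rw [((hD k).integral_inner_sq x).2]
    have : 0 ≤ ∫ z, inner ℝ x (z - μ k) ^ 2 ∂(D k) := integral_nonneg fun z => sq_nonneg _
    exact mul_le_mul_of_nonneg_left (by linarith) (hw k).le
  · have h1 : ∀ k, ∫ z, inner ℝ x (z - μ k) ^ 2 ∂(D k) ≤ sigmaMax D μ ^ 2 * ‖x‖ ^ 2 := fun k => by
      have h2 := dotProduct_mulVec_le_maxEigenvalue (isHermitian_secondMoment (D k) (μ k)) x
      rw [(hD k).dotProduct_secondMoment_mulVec] at h2
      simp only [← sq] at h2
      refine h2.trans (mul_le_mul_of_nonneg_right ?_ (sq_nonneg _))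
      have h3 : √(maxEigenvalue (secondMoment (D k) (μ k))) ≤ sigmaMax D μ :=
        le_ciSup (f := fun k => √(maxEigenvalue (secondMoment (D k) (μ k))))
          (Set.finite_range _).bddAbove k
      -- The real square root is `0` on negative numbers, so a case split replaces a proof that the
      -- eigenvalue is nonnegative.
      rcases le_total 0 (maxEigenvalue (secondMoment (D k) (μ k))) with h4 | h4
      · rw [← Real.sq_sqrt h4]
        gcongr
      · exact h4.trans (sq_nonneg _)
    calc ∑ k, w k * ∫ z, inner ℝ x z ^ 2 ∂(D k)
        ≤ ∑ k, (w k * inner ℝ (μ k) x ^ 2 + w k * (sigmaMax D μ ^ 2 * ‖x‖ ^ 2)) := by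
          refine Finset.sum_le_sum fun k _ => ?_
          rw [((hD k).integral_inner_sq x).2, ← mul_add]
          have := h1 k
          exact mul_le_mul_of_nonneg_left (by linarith) (hw k).le
      _ = _ := by rw [Finset.sum_add_distrib, ← Finset.sum_mul, hw1, one_mul]

/-- The second moments of a sub-gaussian law are of the order of the squared parameter. -/
lemma IsSubGaussian.integral_inner_sq_le {D : Measure (E d)} {K : ℝ} (h : IsSubGaussian D 0 K)
    {x : E d} : ∫ z, inner ℝ x z ^ 2 ∂D ≤ 8 * K ^ 2 * ‖x‖ ^ 2 := by
  rcases eq_or_ne x 0 with rfl | hx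
  · simp
  have hx0 : 0 < ‖x‖ := norm_pos_iff.2 hx
  have hK := h.pos
  have hX := h.hasSubgaussianMGF (v := x) le_rfl
  simp only [sub_zero] at hX
  -- This scale makes the mgf at `±t` at most `exp (1 / 2) ≤ 2`. Combined with `s² ≤ 2 (exp s + exp
  -- (-s))` it yields the constant `2 * (2 + 2) = 8`.
  set t : ℝ := (‖x‖ * K)⁻¹ with ht
  have ht0 : 0 < t := by positivity
  have h1 : ∀ t', t' ^ 2 = t ^ 2 → ∫ z, Real.exp (t' * inner ℝ x z) ∂D ≤ 2 := fun t' ht' => by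
    refine (hX.mgf_le t').trans ?_
    rw [ht', Real.coe_toNNReal _ (sq_nonneg _), ← mul_pow, ht,
      mul_inv_cancel₀ (by positivity), one_pow]
    have h2 : Real.exp (1 / 2) ^ 2 = Real.exp 1 := by rw [← Real.exp_nat_mul]; norm_num
    have := Real.exp_one_lt_d9
    nlinarith [Real.exp_pos (1 / 2)]
  have hp : ∀ z, inner ℝ x z ^ 2
      ≤ 2 * (‖x‖ * K) ^ 2 * (Real.exp (t * inner ℝ x z) + Real.exp (-t * inner ℝ x z)) := fun z => by
    have h2 := Real.pow_div_factorial_le_exp |t * inner ℝ x z| (abs_nonneg _) 2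
    rw [sq_abs, Nat.factorial_two, Nat.cast_ofNat] at h2
    have h3 : Real.exp |t * inner ℝ x z|
        ≤ Real.exp (t * inner ℝ x z) + Real.exp (-t * inner ℝ x z) := by
      rw [neg_mul]
      rcases abs_choice (t * inner ℝ x z) with h | h <;> rw [h]
      · linarith [Real.exp_pos (-(t * inner ℝ x z))]
      · linarith [Real.exp_pos (t * inner ℝ x z)]
    have h4 : inner ℝ x z ^ 2 = 2 * (‖x‖ * K) ^ 2 * ((t * inner ℝ x z) ^ 2 / 2) := by
      rw [ht]
      field_simp
    rw [h4]
    exact mul_le_mul_of_nonneg_left (h2.trans h3) (by positivity)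
  have hi := hX.integrable_exp_mul
  calc ∫ z, inner ℝ x z ^ 2 ∂D
      ≤ ∫ z, 2 * (‖x‖ * K) ^ 2 * (Real.exp (t * inner ℝ x z) + Real.exp (-t * inner ℝ x z)) ∂D :=
        integral_mono_of_nonneg (Filter.Eventually.of_forall fun z => sq_nonneg _)
          (((hi t).add (hi (-t))).const_mul _) (Filter.Eventually.of_forall hp)
    _ = 2 * (‖x‖ * K) ^ 2 * (∫ z, Real.exp (t * inner ℝ x z) ∂D
          + ∫ z, Real.exp (-t * inner ℝ x z) ∂D) := by
        rw [integral_const_mul, integral_add (hi t) (hi (-t))]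
    _ ≤ 2 * (‖x‖ * K) ^ 2 * (2 + 2) := by
        gcongr
        · exact h1 t rfl
        · exact h1 (-t) (by ring)
    _ = _ := by ring

lemma norm_sub_le_maxSep (k l : Fin r) : ‖μ k - μ l‖ ≤ maxSep μ := by
  rcases eq_or_ne k l with rfl | h
  · rw [sub_self, norm_zero]
    exact Real.iSup_nonneg fun p => norm_nonneg _
  · exact le_ciSup (f := fun p : {p : Fin r × Fin r // p.1 ≠ p.2} => ‖μ p.1.1 - μ p.1.2‖)
      (Set.finite_range _).bddAbove ⟨(k, l), h⟩

/-- Centring is what bounds the means by their separations: each `μ k` is the weighted average of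
the differences `μ k - μ l`. -/
lemma sum_mul_inner_sq_le_maxSep (hw : ∀ k, 0 < w k) (hw1 : ∑ k, w k = 1)
    (hμ : ∑ k, w k • μ k = 0) (x : E d) :
    ∑ k, w k * inner ℝ (μ k) x ^ 2 ≤ maxSep μ ^ 2 * ‖x‖ ^ 2 := by
  have h1 : ∀ k, ‖μ k‖ ≤ maxSep μ := fun k => by
    have h2 : μ k = ∑ l, w l • (μ k - μ l) := by
      simp only [smul_sub, Finset.sum_sub_distrib, hμ, ← Finset.sum_smul, hw1, one_smul, sub_zero]
    rw [h2]
    calc ‖∑ l, w l • (μ k - μ l)‖ ≤ ∑ l, w l * maxSep μ := by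
          refine (norm_sum_le _ _).trans (Finset.sum_le_sum fun l _ => ?_)
          rw [norm_smul, Real.norm_eq_abs, abs_of_pos (hw l)]
          exact mul_le_mul_of_nonneg_left (norm_sub_le_maxSep k l) (hw l).le
      _ = maxSep μ := by rw [← Finset.sum_mul, hw1, one_mul]
  calc ∑ k, w k * inner ℝ (μ k) x ^ 2 ≤ ∑ k, w k * (maxSep μ ^ 2 * ‖x‖ ^ 2) := by
        refine Finset.sum_le_sum fun k _ => mul_le_mul_of_nonneg_left ?_ (hw k).le
        rw [← mul_pow, ← sq_abs]
        have h3 := abs_real_inner_le_norm (μ k) x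
        have h4 := mul_le_mul_of_nonneg_right (h1 k) (norm_nonneg x)
        exact pow_le_pow_left₀ (abs_nonneg _) (h3.trans h4) 2
    _ = _ := by rw [← Finset.sum_mul, hw1, one_mul]

lemma norm_le_rowNorm {m : ℕ} (Y : Fin m → E d) (j : Fin m) : ‖Y j‖ ≤ rowNorm Y :=
  le_ciSup (f := fun j => ‖Y j‖) (Set.finite_range _).bddAbove j

end Mixture

/-! ### Sample covariance under contamination. -/

section SampleCovariance

variable {ι : Type*} [Fintype ι] {d : ℕ}

lemma dotProduct_sampleCov_mulVec (z : ι → E d) (x y : E d) :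
    y.ofLp ⬝ᵥ (sampleCov z *ᵥ x.ofLp) = (Fintype.card ι : ℝ)⁻¹ *
      ∑ p, inner ℝ (z p - sampleMean z) x * inner ℝ (z p - sampleMean z) y := by
  rw [sampleCov, Matrix.smul_mulVec, dotProduct_smul, Matrix.sum_mulVec, dotProduct_sum,
    smul_eq_mul]
  congr 1
  refine Finset.sum_congr rfl fun p _ => ?_
  exact dotProduct_vecMulVec_mulVec (z p - sampleMean z) x y

lemma isHermitian_sampleCov (z : ι → E d) : (sampleCov z).IsHermitian := by
  ext i j
  simp only [sampleCov, Matrix.conjTranspose_apply, star_trivial, Matrix.smul_apply,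
    Matrix.sum_apply, Matrix.vecMulVec_apply, mul_comm]

lemma dotProduct_sampleCov_mulVec_nonneg (z : ι → E d) (x : E d) :
    0 ≤ x.ofLp ⬝ᵥ (sampleCov z *ᵥ x.ofLp) := by
  rw [dotProduct_sampleCov_mulVec]
  exact mul_nonneg (by positivity) (Finset.sum_nonneg fun p _ => mul_self_nonneg _)

lemma dotProduct_sampleCov_mulVec_eq [Nonempty ι] (z : ι → E d) (x : E d) :
    x.ofLp ⬝ᵥ (sampleCov z *ᵥ x.ofLp) = (Fintype.card ι : ℝ)⁻¹ * ∑ p, inner ℝ x (z p) ^ 2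
      - inner ℝ x (sampleMean z) ^ 2 := by
  have hc : (Fintype.card ι : ℝ) ≠ 0 := by exact_mod_cast Fintype.card_ne_zero
  have h1 : inner ℝ x (sampleMean z) = (Fintype.card ι : ℝ)⁻¹ * ∑ p, inner ℝ x (z p) := by
    rw [sampleMean, real_inner_smul_right, inner_sum]
  rw [dotProduct_sampleCov_mulVec]
  have h2 : ∀ p, inner ℝ (z p - sampleMean z) x * inner ℝ (z p - sampleMean z) x
      = inner ℝ x (z p) ^ 2 - 2 * inner ℝ x (sampleMean z) * inner ℝ x (z p)
        + inner ℝ x (sampleMean z) ^ 2 := fun p => by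
    rw [real_inner_comm, inner_sub_right]
    ring
  simp only [h2]
  rw [Finset.sum_add_distrib, Finset.sum_sub_distrib, ← Finset.mul_sum, Finset.sum_const,
    Finset.card_univ, nsmul_eq_mul]
  have h3 : ∑ p, inner ℝ x (z p) = Fintype.card ι * inner ℝ x (sampleMean z) := by
    rw [h1]
    field_simp
  rw [h3]
  field_simp
  ring

/-- The sample covariance of a contaminated sample is close to the covariance of the inliers. -/
theorem abs_sampleCov_sub_le {n m M : ℕ} {z : Fin n ⊕ Fin m → E d} {S : Finset (Fin n ⊕ Fin m)}
    (hS : S.card = M) (hM : 0 < M) {A h : E d → ℝ} {a b R ρ σ : ℝ} (hb : 0 ≤ b)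
    (hh : ∀ x, 0 ≤ h x) (hhR : ∀ x, h x ≤ R * ‖x‖ ^ 2) (hhA : ∀ x, h x ≤ A x)
    (hAh : ∀ x, A x ≤ h x + σ ^ 2 * ‖x‖ ^ 2)
    (hR : ∀ j, ‖z (Sum.inr j)‖ ^ 2 ≤ R) (hR0 : 0 ≤ R)
    (hout : (S.toRight.card : ℝ) ≤ ρ * M)
    (hcov : ∀ x : E d, |∑ i ∈ S.toLeft, (inner ℝ x (z (Sum.inl i)) ^ 2 - A x)|
      ≤ a * M * ‖x‖ ^ 2)
    (hmean : ‖∑ i ∈ S.toLeft, z (Sum.inl i)‖ ^ 2 ≤ b * M ^ 2) (x : E d) :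
    |x.ofLp ⬝ᵥ (sampleCov (fun p : S => z p) *ᵥ x.ofLp) - h x|
      ≤ (a + σ ^ 2 + 2 * b + 3 * ρ * R) * ‖x‖ ^ 2 := by
  have hM0 : (0 : ℝ) < M := by exact_mod_cast hM
  have : Nonempty S := (Finset.card_pos.1 (hS ▸ hM)).to_subtype
  have hcardS : (Fintype.card S : ℝ) = M := by rw [Fintype.card_coe, hS]
  have hsplit : ∀ {G : Type} [AddCommMonoid G] (f : Fin n ⊕ Fin m → G), ∑ p : S, f p
      = ∑ i ∈ S.toLeft, f (Sum.inl i) + ∑ j ∈ S.toRight, f (Sum.inr j) := fun f => by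
    rw [Finset.sum_coe_sort S f, ← Finset.sum_disjSum, Finset.toLeft_disjSum_toRight]
  have hcards : (S.toLeft.card : ℝ) + S.toRight.card = M := by
    rw [← hS]
    exact_mod_cast Finset.card_toLeft_add_card_toRight
  set o : ℝ := S.toRight.card / M with ho
  have ho0 : 0 ≤ o := by positivity
  have hoρ : o ≤ ρ := by rwa [ho, div_le_iff₀ hM0]
  have ho1 : o ≤ 1 := by
    rw [ho, div_le_one hM0]
    have : (0 : ℝ) ≤ S.toLeft.card := by positivity
    linarith
  rw [dotProduct_sampleCov_mulVec_eq, hcardS, hsplit fun p => inner ℝ x (z p) ^ 2]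
  have e1 : (M : ℝ)⁻¹ * ∑ i ∈ S.toLeft, inner ℝ x (z (Sum.inl i)) ^ 2
      = (M : ℝ)⁻¹ * ∑ i ∈ S.toLeft, (inner ℝ x (z (Sum.inl i)) ^ 2 - A x) + (1 - o) * A x := by
    rw [Finset.sum_sub_distrib, Finset.sum_const, nsmul_eq_mul]
    have : (S.toLeft.card : ℝ) = M * (1 - o) := by
      rw [ho]
      field_simp
      linarith
    rw [this]
    field_simp
    ring
  have e2 : |(M : ℝ)⁻¹ * ∑ i ∈ S.toLeft, (inner ℝ x (z (Sum.inl i)) ^ 2 - A x)|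
      ≤ a * ‖x‖ ^ 2 := by
    rw [abs_mul, abs_of_pos (inv_pos.2 hM0), inv_mul_le_iff₀ hM0]
    refine (hcov x).trans (le_of_eq (by ring))
  have e3 : (M : ℝ)⁻¹ * ∑ j ∈ S.toRight, inner ℝ x (z (Sum.inr j)) ^ 2 ≤ o * R * ‖x‖ ^ 2 := by
    rw [inv_mul_le_iff₀ hM0]
    calc ∑ j ∈ S.toRight, inner ℝ x (z (Sum.inr j)) ^ 2
        ≤ ∑ _j ∈ S.toRight, R * ‖x‖ ^ 2 := by
          refine Finset.sum_le_sum fun j _ => ?_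
          rw [← sq_abs]
          calc |inner ℝ x (z (Sum.inr j))| ^ 2 ≤ (‖x‖ * ‖z (Sum.inr j)‖) ^ 2 := by
                gcongr
                exact abs_real_inner_le_norm _ _
            _ = ‖z (Sum.inr j)‖ ^ 2 * ‖x‖ ^ 2 := by ring
            _ ≤ _ := by gcongr; exact hR j
      _ = _ := by
          rw [Finset.sum_const, nsmul_eq_mul, ho]
          field_simp
  have e3' : 0 ≤ (M : ℝ)⁻¹ * ∑ j ∈ S.toRight, inner ℝ x (z (Sum.inr j)) ^ 2 :=
    mul_nonneg (by positivity) (Finset.sum_nonneg fun j _ => sq_nonneg _)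
  have e4 : ‖sampleMean fun p : S => z p‖ ^ 2 ≤ 2 * b + 2 * (o * R) := by
    have hzO : ‖∑ j ∈ S.toRight, z (Sum.inr j)‖ ≤ o * M * √R := by
      calc ‖∑ j ∈ S.toRight, z (Sum.inr j)‖ ≤ ∑ _j ∈ S.toRight, √R := by
            refine (norm_sum_le _ _).trans (Finset.sum_le_sum fun j _ => ?_)
            exact Real.le_sqrt_of_sq_le (hR j)
        _ = o * M * √R := by
            rw [Finset.sum_const, nsmul_eq_mul, ho]
            field_simp
    have hzI : ‖∑ i ∈ S.toLeft, z (Sum.inl i)‖ ^ 2 ≤ b * M ^ 2 := hmean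
    rw [sampleMean, hcardS, norm_smul, mul_pow, Real.norm_eq_abs, sq_abs, hsplit, inv_pow,
      inv_mul_le_iff₀ (by positivity)]
    set P := ‖∑ i ∈ S.toLeft, z (Sum.inl i)‖
    set Q := ‖∑ j ∈ S.toRight, z (Sum.inr j)‖ with hQ
    -- Cauchy–Schwarz would leave `o²`; one factor `o ≤ 1` is dropped so that the outliers enter
    -- linearly.
    have hQ2 : Q ^ 2 ≤ o * R * M ^ 2 := by
      calc Q ^ 2 ≤ (o * M * √R) ^ 2 := by gcongr
        _ = o * (o * R * M ^ 2) := by rw [mul_pow, mul_pow, Real.sq_sqrt hR0]; ring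
        _ ≤ 1 * (o * R * M ^ 2) := by gcongr
        _ = _ := one_mul _
    calc ‖∑ i ∈ S.toLeft, z (Sum.inl i) + ∑ j ∈ S.toRight, z (Sum.inr j)‖ ^ 2
        ≤ (P + Q) ^ 2 := by gcongr; exact norm_add_le _ _
      _ ≤ 2 * P ^ 2 + 2 * Q ^ 2 := by nlinarith [sq_nonneg (P - Q)]
      _ ≤ _ := by linarith
  have e5 : inner ℝ x (sampleMean fun p : S => z p) ^ 2 ≤ (2 * b + 2 * (o * R)) * ‖x‖ ^ 2 := by
    rw [← sq_abs]
    calc |inner ℝ x (sampleMean fun p : S => z p)| ^ 2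
        ≤ (‖x‖ * ‖sampleMean fun p : S => z p‖) ^ 2 := by
          gcongr
          exact abs_real_inner_le_norm _ _
      _ = ‖sampleMean fun p : S => z p‖ ^ 2 * ‖x‖ ^ 2 := by ring
      _ ≤ _ := by gcongr
  have e5' := sq_nonneg (inner ℝ x (sampleMean fun p : S => z p))
  have hoR : o * R * ‖x‖ ^ 2 ≤ ρ * R * ‖x‖ ^ 2 := by gcongr
  have hoR0 : 0 ≤ o * R * ‖x‖ ^ 2 := by positivity
  have hbx : 0 ≤ b * ‖x‖ ^ 2 := by positivity
  have hσx : 0 ≤ σ ^ 2 * ‖x‖ ^ 2 := by positivity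
  have hoh : o * h x ≤ o * R * ‖x‖ ^ 2 := by
    rw [mul_assoc]
    exact mul_le_mul_of_nonneg_left (hhR x) ho0
  have hoA : (1 - o) * h x ≤ (1 - o) * A x :=
    mul_le_mul_of_nonneg_left (hhA x) (by linarith)
  have hoA' : 0 ≤ o * A x := mul_nonneg ho0 ((hh x).trans (hhA x))
  have hA := hAh x
  -- From above, the losses are the fluctuation, the noise `σ²` and the outliers' own second moment.
  -- From below, the missing inliers cost `o R` and the squared mean costs `2 b + 2 o R`, whence `3
  -- ρ R`.
  rw [mul_add, e1]
  obtain ⟨e2a, e2b⟩ := abs_le.1 e2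
  rw [abs_le]
  constructor <;> nlinarith

end SampleCovariance

end SGMM

namespace SGMM

/-! ### The number of outliers in a random split, and averaging over splits. -/

section RandomSplit

/-- In probabilistic terms, `k` given indices all fall into a random `M`-set with probability at
most `(M / N) ^ k`: the exact value is a product of factors `(M - i) / (N - i)`, each at most `M /
N`. -/
lemma choose_sub_mul_pow_le {N M : ℕ} (hMN : M ≤ N) :
    ∀ k ≤ M, (N - k).choose (M - k) * N ^ k ≤ N.choose M * M ^ k := by
  intro k
  induction k with
  | zero => simp
  | succ k ih =>
    intro hk
    have ih := ih (by omega)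
    obtain ⟨b, hb⟩ : ∃ b, M = b + 1 + k := ⟨M - (k + 1), by omega⟩
    obtain ⟨a, ha⟩ : ∃ a, N = a + 1 + k := ⟨N - (k + 1), by omega⟩
    have e1 : N - (k + 1) = a := by omega
    have e2 : M - (k + 1) = b := by omega
    have e3 : N - k = a + 1 := by omega
    have e4 : M - k = b + 1 := by omega
    rw [e3, e4] at ih
    rw [e1, e2]
    have h1 := Nat.add_one_mul_choose_eq a b
    have h2 : (b + 1) * N ≤ (a + 1) * M := by
      rw [hb, ha]
      have : b ≤ a := by omega
      nlinarith
    refine le_of_mul_le_mul_left (a := a + 1) ?_ (Nat.succ_pos a)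
    calc (a + 1) * (a.choose b * N ^ (k + 1)) = (a + 1) * a.choose b * (N * N ^ k) := by ring
      _ = (a + 1).choose (b + 1) * ((b + 1) * N) * N ^ k := by rw [h1]; ring
      _ ≤ (a + 1).choose (b + 1) * ((a + 1) * M) * N ^ k := by gcongr
      _ = (a + 1) * M * ((a + 1).choose (b + 1) * N ^ k) := by ring
      _ ≤ (a + 1) * M * (N.choose M * M ^ k) := by gcongr
      _ = _ := by ring

variable {n m M : ℕ}

lemma card_filter_subset_toRight_le (T : Finset (Fin m)) :
    ((Finset.powersetCard M (Finset.univ : Finset (Fin n ⊕ Fin m))).filter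
      fun S => T ⊆ S.toRight).card ≤ (n + m - T.card).choose (M - T.card) := by
  classical
  set T' : Finset (Fin n ⊕ Fin m) := T.map Function.Embedding.inr
  have hT' : T'.card = T.card := Finset.card_map _
  have hsub : ∀ S : Finset (Fin n ⊕ Fin m), T ⊆ S.toRight → T' ⊆ S := fun S hS p hp => by
    obtain ⟨j, hj, rfl⟩ := Finset.mem_map.1 hp
    exact Finset.mem_toRight.1 (hS hj)
  have h1 : (Finset.powersetCard (M - T.card) (Finset.univ \ T')).card
      = (n + m - T.card).choose (M - T.card) := by
    rw [Finset.card_powersetCard, Finset.card_sdiff_of_subset (Finset.subset_univ _), hT',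
      Finset.card_univ, Fintype.card_sum, Fintype.card_fin, Fintype.card_fin]
  rw [← h1]
  refine Finset.card_le_card_of_injOn (fun S => S \ T') ?_ ?_
  · intro S hS
    obtain ⟨hS1, hS2⟩ := Finset.mem_filter.1 hS
    have hSc := (Finset.mem_powersetCard.1 hS1).2
    refine Finset.mem_powersetCard.2 ⟨Finset.sdiff_subset_sdiff (Finset.subset_univ _) subset_rfl, ?_⟩
    rw [Finset.card_sdiff_of_subset (hsub S hS2), hSc, hT']
  · intro S hS S' hS' heq
    have h2 := hsub S (Finset.mem_filter.1 hS).2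
    have h3 := hsub S' (Finset.mem_filter.1 hS').2
    rw [← Finset.sdiff_union_of_subset h2, ← Finset.sdiff_union_of_subset h3]
    exact congrArg (· ∪ T') heq

/-- The generating function of the hypergeometric law is bounded by the binomial one. -/
lemma sum_two_pow_card_toRight_le (hM : M ≤ n + m) (hM0 : 0 < M) :
    ∑ S ∈ Finset.powersetCard M (Finset.univ : Finset (Fin n ⊕ Fin m)), (2 : ℝ) ^ S.toRight.card
      ≤ (n + m).choose M * Real.exp (m * M / (n + m : ℕ)) := by
  classical
  have hN' : (0 : ℝ) < (n + m : ℕ) := by exact_mod_cast hM0.trans_le hM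
  -- The power of two counts the sets of outliers contained in `S`. Exchanging the sums reduces the
  -- bound to inclusion probabilities, which add up to at most `(1 + M / N) ^ m`.
  have h1 : ∀ S : Finset (Fin n ⊕ Fin m), (2 : ℝ) ^ S.toRight.card
      = ∑ T : Finset (Fin m), if T ⊆ S.toRight then 1 else 0 := fun S => by
    rw [Finset.sum_boole]
    have : (Finset.univ.filter fun T => T ⊆ S.toRight) = S.toRight.powerset := by
      ext T
      simp
    rw [this, Finset.card_powerset]
    push_cast
    rfl
  have h2 : ∀ T : Finset (Fin m),
      ∑ S ∈ Finset.powersetCard M (Finset.univ : Finset (Fin n ⊕ Fin m)),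
        (if T ⊆ S.toRight then (1 : ℝ) else 0)
      ≤ (n + m).choose M * (M / (n + m : ℕ)) ^ T.card := fun T => by
    rw [Finset.sum_boole]
    rcases le_or_gt T.card M with hT | hT
    · have h3 := card_filter_subset_toRight_le (n := n) (M := M) T
      have h4 := choose_sub_mul_pow_le hM T.card hT
      rw [div_pow, ← mul_div_assoc, le_div_iff₀ (by positivity)]
      exact_mod_cast (Nat.mul_le_mul_right _ h3).trans h4
    · have : ((Finset.powersetCard M (Finset.univ : Finset (Fin n ⊕ Fin m))).filter
          fun S => T ⊆ S.toRight) = ∅ := by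
        refine Finset.filter_eq_empty_iff.2 fun S hS hTS => ?_
        have h5 := Finset.card_le_card hTS
        have h6 := (Finset.mem_powersetCard.1 hS).2
        have h7 := Finset.card_toLeft_add_card_toRight (u := S)
        omega
      rw [this]
      simp only [Finset.card_empty, Nat.cast_zero]
      positivity
  simp only [h1]
  rw [Finset.sum_comm]
  refine (Finset.sum_le_sum fun T _ => h2 T).trans ?_
  rw [← Finset.mul_sum]
  gcongr
  have h3 := Fintype.sum_pow_mul_eq_add_pow (Fin m) ((M : ℝ) / (n + m : ℕ)) 1
  simp only [one_pow, mul_one, Fintype.card_fin] at h3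
  rw [h3, mul_div_assoc, Real.exp_nat_mul]
  gcongr
  exact Real.add_one_le_exp _

/-- Few sets of size `M` contain many more outliers than expected. -/
lemma card_filter_lt_card_toRight_le (hM : M ≤ n + m) (hM0 : 0 < M) :
    (((Finset.powersetCard M (Finset.univ : Finset (Fin n ⊕ Fin m))).filter
      fun S => 3 * (m * M / (n + m : ℕ) + Real.log M) < (S.toRight.card : ℝ)).card : ℝ)
      ≤ (n + m).choose M / M := by
  classical
  set q : ℝ := m * M / (n + m : ℕ) with hq
  have hq0 : 0 ≤ q := by positivity
  have hM0' : (0 : ℝ) < M := by exact_mod_cast hM0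
  have hM1 : (1 : ℝ) ≤ M := by exact_mod_cast hM0
  have hL : 0 ≤ Real.log M := Real.log_nonneg hM1
  set 𝒮 := (Finset.powersetCard M (Finset.univ : Finset (Fin n ⊕ Fin m))).filter
      fun S => 3 * (q + Real.log M) < (S.toRight.card : ℝ) with h𝒮
  -- Markov's inequality for `2 ^ card`. The factor `3` in the threshold suffices because `3 log 2 >
  -- 1`.
  have h1 : (𝒮.card : ℝ) * (Real.exp q * M) ≤ (n + m).choose M * Real.exp q := by
    calc (𝒮.card : ℝ) * (Real.exp q * M) = ∑ S ∈ 𝒮, Real.exp q * M := by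
          rw [Finset.sum_const, nsmul_eq_mul]
      _ ≤ ∑ S ∈ 𝒮, (2 : ℝ) ^ S.toRight.card := by
          refine Finset.sum_le_sum fun S hS => ?_
          have h2 := (Finset.mem_filter.1 hS).2
          have h3 := Real.log_two_gt_d9
          calc Real.exp q * M = Real.exp (q + Real.log M) := by
                rw [Real.exp_add, Real.exp_log hM0']
            _ ≤ Real.exp (S.toRight.card * Real.log 2) := by
                rw [Real.exp_le_exp]
                nlinarith
            _ = (2 : ℝ) ^ S.toRight.card := by
                rw [Real.exp_nat_mul, Real.exp_log (by norm_num)]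
      _ ≤ ∑ S ∈ Finset.powersetCard M (Finset.univ : Finset (Fin n ⊕ Fin m)),
            (2 : ℝ) ^ S.toRight.card :=
          Finset.sum_le_sum_of_subset_of_nonneg (Finset.filter_subset _ _)
            fun _ _ _ => by positivity
      _ ≤ _ := sum_two_pow_card_toRight_le hM hM0
  rw [le_div_iff₀ hM0']
  refine le_of_mul_le_mul_right ?_ (Real.exp_pos q)
  linarith

variable {Ω : Type*} [MeasurableSpace Ω] {Pr : Measure Ω} [IsProbabilityMeasure Pr] {d r : ℕ}
  {φ : Fin n → Ω → Fin r} {y : Fin n ⊕ Fin m → Ω → E d} {P : Ω → Finset (Fin n ⊕ Fin m)}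

lemma IsRandomSplit.measureReal_card_toRight_le (hP : IsRandomSplit Pr φ y M P) (hM0 : 0 < M)
    (hM : M ≤ n + m) :
    Pr.real {ω | 3 * (m * M / (n + m : ℕ) + Real.log M) < ((P ω).toRight.card : ℝ)} ≤ 1 / M := by
  classical
  set 𝒮 := (Finset.powersetCard M (Finset.univ : Finset (Fin n ⊕ Fin m))).filter
      fun S => 3 * (m * M / (n + m : ℕ) + Real.log M) < (S.toRight.card : ℝ) with h𝒮
  have hC : (0 : ℝ) < (n + m).choose M := by exact_mod_cast Nat.choose_pos hM
  have h1 : {ω | 3 * (m * M / (n + m : ℕ) + Real.log M) < ((P ω).toRight.card : ℝ)}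
      ⊆ ⋃ S ∈ 𝒮, P ⁻¹' {S} := fun ω hω => by
    refine Set.mem_biUnion (x := P ω) (Finset.mem_filter.2 ⟨?_, hω⟩) rfl
    exact Finset.mem_powersetCard.2 ⟨Finset.subset_univ _, hP.card_eq ω⟩
  calc _ ≤ Pr.real (⋃ S ∈ 𝒮, P ⁻¹' {S}) := measureReal_mono h1 (measure_ne_top _ _)
    _ ≤ ∑ S ∈ 𝒮, Pr.real (P ⁻¹' {S}) := measureReal_biUnion_finset_le _ _
    _ = ∑ S ∈ 𝒮, ((n + m).choose M : ℝ)⁻¹ := by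
        refine Finset.sum_congr rfl fun S hS => ?_
        rw [measureReal_def, hP.uniform S
          (Finset.mem_powersetCard.1 (Finset.mem_filter.1 hS).1).2]
        simp
    _ = 𝒮.card * ((n + m).choose M : ℝ)⁻¹ := by rw [Finset.sum_const, nsmul_eq_mul]
    _ ≤ (n + m).choose M / M * ((n + m).choose M : ℝ)⁻¹ := by
        gcongr
        exact card_filter_lt_card_toRight_le hM hM0
    _ = 1 / M := by field_simp

/-- An event on the data which is rare for each set of indices is rare for a random one. -/
lemma IsRandomSplit.measureReal_mem_le (hP : IsRandomSplit Pr φ y M P)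
    (hy : ∀ p, Measurable (y p))
    {B : Finset (Fin n ⊕ Fin m) → Set (Fin n ⊕ Fin m → E d)} (hB : ∀ S, MeasurableSet (B S))
    {ε : ℝ} (hε : 0 ≤ ε) (hBε : ∀ S, S.card = M → Pr.real {ω | (fun p => y p ω) ∈ B S} ≤ ε) :
    Pr.real {ω | (fun p => y p ω) ∈ B (P ω)} ≤ ε := by
  classical
  have hym : Measurable fun ω p => y p ω := measurable_pi_lambda _ hy
  have hPm : ∀ S, MeasurableSet (P ⁻¹' {S}) := fun S => hP.measurable (measurableSet_singleton S)
  have hind : IndepFun P (fun ω p => y p ω) Pr :=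
    hP.indep.comp measurable_id measurable_snd
  set 𝒮 := Finset.powersetCard M (Finset.univ : Finset (Fin n ⊕ Fin m))
  have h1 : {ω | (fun p => y p ω) ∈ B (P ω)}
      ⊆ ⋃ S ∈ 𝒮, P ⁻¹' {S} ∩ {ω | (fun p => y p ω) ∈ B S} := fun ω hω =>
    Set.mem_biUnion (x := P ω)
      (Finset.mem_powersetCard.2 ⟨Finset.subset_univ _, hP.card_eq ω⟩) ⟨rfl, hω⟩
  calc _ ≤ Pr.real (⋃ S ∈ 𝒮, P ⁻¹' {S} ∩ {ω | (fun p => y p ω) ∈ B S}) := measureReal_mono h1 (measure_ne_top _ _)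
    _ ≤ ∑ S ∈ 𝒮, Pr.real (P ⁻¹' {S} ∩ {ω | (fun p => y p ω) ∈ B S}) :=
        measureReal_biUnion_finset_le _ _
    _ ≤ ∑ S ∈ 𝒮, Pr.real (P ⁻¹' {S}) * ε := by
        refine Finset.sum_le_sum fun S hS => ?_
        have h2 := hind.measure_inter_preimage_eq_mul {S} (B S) (measurableSet_singleton S) (hB S)
        have h3 : Pr.real (P ⁻¹' {S} ∩ {ω | (fun p => y p ω) ∈ B S})
            = Pr.real (P ⁻¹' {S}) * Pr.real {ω | (fun p => y p ω) ∈ B S} := by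
          simp only [measureReal_def, ← ENNReal.toReal_mul]
          exact congrArg ENNReal.toReal h2
        rw [h3]
        gcongr
        exact hBε S (Finset.mem_powersetCard.1 hS).2
    -- The events `P = S` are disjoint, so no factor for the number of splits is lost.
    _ = Pr.real (⋃ S ∈ 𝒮, P ⁻¹' {S}) * ε := by
        rw [measureReal_biUnion_finset _ fun S _ => hPm S, Finset.sum_mul]
        intro S _ S' _ hne
        exact Set.disjoint_left.2 fun ω h h' => hne (h.symm.trans h')
    _ ≤ 1 * ε := by
        gcongr
        exact measureReal_le_one
    _ = ε := one_mul ε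

end RandomSplit

end SGMM

namespace SGMM

/-! ### Conditional law of the inliers outside of the split. -/

section Conditional

/-- The joint law of `W`, `A`, `O` is a triple product, and products of measures are associative.
Used with `W` the inliers outside of the split, `A` those inside, `O` the outliers. -/
lemma indepFun_prodMk_right {Ω α β γ : Type*} [MeasurableSpace Ω] [MeasurableSpace α]
    [MeasurableSpace β] [MeasurableSpace γ] {Pr : Measure Ω} [IsProbabilityMeasure Pr]
    {W : Ω → α} {A : Ω → β} {O : Ω → γ} (hW : Measurable W) (hA : Measurable A)
    (hO : Measurable O) (h1 : IndepFun W A Pr) (h2 : IndepFun (fun ω => (W ω, A ω)) O Pr) :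
    IndepFun W (fun ω => (A ω, O ω)) Pr := by
  have := Measure.isProbabilityMeasure_map (μ := Pr) hW.aemeasurable
  have := Measure.isProbabilityMeasure_map (μ := Pr) hA.aemeasurable
  have := Measure.isProbabilityMeasure_map (μ := Pr) hO.aemeasurable
  have hAO : IndepFun A O Pr := h2.comp measurable_snd measurable_id
  rw [indepFun_iff_map_prod_eq_prod_map_map hW.aemeasurable (hA.prodMk hO).aemeasurable,
    (indepFun_iff_map_prod_eq_prod_map_map hA.aemeasurable hO.aemeasurable).1 hAO]
  rw [indepFun_iff_map_prod_eq_prod_map_map (hW.prodMk hA).aemeasurable hO.aemeasurable,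
    (indepFun_iff_map_prod_eq_prod_map_map hW.aemeasurable hA.aemeasurable).1 h1] at h2
  have h3 := (measurePreserving_prodAssoc (Pr.map W) (Pr.map A) (Pr.map O)).map_eq
  rw [← h2, Measure.map_map MeasurableEquiv.prodAssoc.measurable ((hW.prodMk hA).prodMk hO)] at h3
  exact h3

/-- Conditionally on `Z`, a function of `Z` and of an independent variable `W` has the law of the
function with its first argument frozen. -/
lemma condDistrib_eq_map_of_map_prodMk_eq_prod {Ω α β γ : Type*} [MeasurableSpace Ω]
    [MeasurableSpace α] [MeasurableSpace β] [MeasurableSpace γ] [StandardBorelSpace γ] [Nonempty γ]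
    {Pr : Measure Ω} [IsFiniteMeasure Pr] {Z : Ω → α} {W : Ω → β} (hZ : Measurable Z)
    (hW : Measurable W) {ρ : Measure β} [IsProbabilityMeasure ρ]
    (h : Pr.map (fun ω => (Z ω, W ω)) = (Pr.map Z).prod ρ) {f : α × β → γ} (hf : Measurable f) :
    ∀ᵐ z ∂(Pr.map Z),
      condDistrib (fun ω => f (Z ω, W ω)) Z Pr z = ρ.map (fun w => f (z, w)) := by
  let κ : Kernel α γ :=
    { toFun := fun z => ρ.map fun w => f (z, w)
      measurable' := by
        refine Measure.measurable_of_measurable_coe _ fun s hs => ?_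
        have h1 : ∀ z, (ρ.map fun w => f (z, w)) s = ρ (Prod.mk z ⁻¹' (f ⁻¹' s)) := fun z => by
          exact Measure.map_apply (hf.comp measurable_prodMk_left) hs
        simp only [h1]
        exact measurable_measure_prodMk_left (hf hs) }
  have hκ : ∀ z, κ z = ρ.map fun w => f (z, w) := fun _ => rfl
  have : IsMarkovKernel κ := ⟨fun z => by
    rw [hκ]
    exact Measure.isProbabilityMeasure_map (hf.comp measurable_prodMk_left).aemeasurable⟩
  refine condDistrib_ae_eq_of_measure_eq_compProd (κ := κ) Z
    (hf.comp (hZ.prodMk hW)).aemeasurable ?_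
  ext s hs
  have hg : Measurable fun p : α × β => (p.1, f p) := measurable_fst.prodMk hf
  have h2 : Pr.map (fun ω => (Z ω, f (Z ω, W ω)))
      = (Pr.map fun ω => (Z ω, W ω)).map fun p => (p.1, f p) := by
    rw [Measure.map_map hg (hZ.prodMk hW)]
    rfl
  refine (congrArg (fun ν => ν s) h2).trans ?_
  rw [h, Measure.map_apply hg hs, Measure.prod_apply (hg hs), Measure.compProd_apply hs]
  refine lintegral_congr fun z => ?_
  exact (Measure.map_apply (hf.comp measurable_prodMk_left) (measurable_prodMk_left hs)).symm

/-- Lets the data be treated under `Pr` itself once the split is fixed. -/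
lemma map_cond_preimage_eq_of_indepFun {Ω α β : Type*} [MeasurableSpace Ω] [MeasurableSpace α]
    [MeasurableSpace β] {Pr : Measure Ω} [IsProbabilityMeasure Pr] {P : Ω → α} {T : Ω → β}
    (hP : Measurable P) (hT : Measurable T) (h : IndepFun P T Pr) {s : Set α}
    (hs : MeasurableSet s) (hs0 : Pr (P ⁻¹' s) ≠ 0) : (Pr[|P ⁻¹' s]).map T = Pr.map T := by
  ext A hA
  rw [Measure.map_apply hT hA, Measure.map_apply hT hA, cond_apply (hP hs),
    h.measure_inter_preimage_eq_mul s A hs hA, ← mul_assoc,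
    ENNReal.inv_mul_cancel hs0 (measure_ne_top _ _), one_mul]

variable {Ω : Type*} [MeasurableSpace Ω] {Pr : Measure Ω} [IsProbabilityMeasure Pr]
  {n m d r M : ℕ} {w : Fin r → ℝ} {D : Fin r → Measure (E d)}
  {φ : Fin n → Ω → Fin r} {y : Fin n ⊕ Fin m → Ω → E d} {P : Ω → Finset (Fin n ⊕ Fin m)}

/-- Inliers outside of `S` are independent of the points in `S`. -/
lemma IsSample.indepFun_points (h : IsSample Pr w D φ y) (S : Finset (Fin n ⊕ Fin m)) :
    IndepFun (fun ω (i : {i : Fin n // Sum.inl i ∉ S}) => (φ i ω, y (Sum.inl i.1) ω))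
      (fun ω (p : S) => y p ω) Pr := by
  classical
  have hX : ∀ i : Fin n, Measurable fun ω => (φ i ω, y (Sum.inl i) ω) := fun i =>
    (h.measurable_label i).prodMk (h.measurable_point _)
  have hO : Measurable fun ω (j : Fin m) => y (Sum.inr j) ω :=
    measurable_pi_lambda _ fun j => h.measurable_point _
  have h1 := h.inlier_indep.indepFun_finset S.toLeftᶜ S.toLeft disjoint_compl_left hX
  have h2 : IndepFun (fun ω => (fun i : (S.toLeftᶜ : Finset (Fin n)) => (φ i ω, y (Sum.inl i) ω),
      fun i : S.toLeft => (φ i ω, y (Sum.inl i) ω)))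
      (fun ω (j : Fin m) => y (Sum.inr j) ω) Pr :=
    h.outlier_indep.comp (φ := fun x => (fun i : (S.toLeftᶜ : Finset (Fin n)) => x i,
      fun i : S.toLeft => x i)) (by fun_prop) measurable_id
  have hr : ∀ s : Finset (Fin n), Measurable fun ω (i : s) => (φ i ω, y (Sum.inl i) ω) :=
    fun s => measurable_pi_lambda _ fun i => hX i
  have h3 := indepFun_prodMk_right (hr _) (hr _) hO h1 h2
  let g : (S.toLeft → Fin r × E d) × (Fin m → E d) → S → E d := fun q p =>
    match p with
    | ⟨Sum.inl i, hi⟩ => (q.1 ⟨i, Finset.mem_toLeft.2 hi⟩).2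
    | ⟨Sum.inr j, _⟩ => q.2 j
  have hg : Measurable g := by
    refine measurable_pi_lambda _ fun p => ?_
    obtain ⟨i | j, hp⟩ := p
    · exact measurable_snd.comp ((measurable_pi_apply _).comp measurable_fst)
    · exact (measurable_pi_apply _).comp measurable_snd
  have h4 := h3.comp (φ := fun x (i : {i : Fin n // Sum.inl i ∉ S}) =>
    x ⟨i.1, Finset.mem_compl.2 fun hi => i.2 (Finset.mem_toLeft.1 hi)⟩) (ψ := g)
    (by fun_prop) hg
  refine (congrArg₂ (fun a b => IndepFun a b Pr) ?_ ?_).mp h4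
  · rfl
  · ext1 ω
    ext1 p
    obtain ⟨i | j, hp⟩ := p <;> rfl

lemma map_prodMap_labelledMixture {q : ℕ} [∀ k, IsProbabilityMeasure (D k)] {g : E d → E q}
    (hg : Measurable g) :
    (labelledMixture w D).map (fun x => (x.1, g x.2)) = labelledMixture w fun k => (D k).map g := by
  have hm : Measurable fun x : Fin r × E d => (x.1, g x.2) := by fun_prop
  rw [labelledMixture, Measure.map_finset_sum hm.aemeasurable, labelledMixture]
  refine Finset.sum_congr rfl fun k _ => ?_
  rw [Measure.map_smul]
  congr 1
  have h1 := Measure.map_prod_map (Measure.dirac k) (D k) measurable_id hg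
  rw [Measure.map_id] at h1
  exact h1.symm

lemma measurable_proj {q : ℕ} {α : Type*} [MeasurableSpace α] {V : α → Matrix (Fin d) (Fin q) ℝ}
    (hV : ∀ a b, Measurable fun z => V z a b) {g : α → E d} (hg : Measurable g) :
    Measurable fun z => proj (V z) (g z) := by
  refine (WithLp.measurable_toLp 2 _).comp (measurable_pi_lambda _ fun j => ?_)
  simp only [Matrix.mulVec, dotProduct, Matrix.transpose_apply]
  have : ∀ i, Measurable fun z => (g z) i := fun i => by fun_prop
  exact Finset.measurable_sum _ fun i _ => (hV i j).mul (this i)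

/-- Conditionally on the split and on the points in it, the other inliers are projected to an
independent sample of the projected mixture. -/
theorem condDistrib_projected_inliers [NeZero r] [∀ k, IsProbabilityMeasure (D k)]
    (hw : ∀ k, 0 < w k) (hw1 : ∑ k, w k = 1) (h : IsSample Pr w D φ y)
    (hP : IsRandomSplit Pr φ y M P) {q : ℕ} {S : Finset (Fin n ⊕ Fin m)} (hS : S.card = M)
    {V : (S → E d) → Matrix (Fin d) (Fin q) ℝ} (hV : ∀ a b, Measurable fun z => V z a b) :
    ∀ᵐ z ∂(Pr[|P ⁻¹' {S}]).map (fun ω (p : S) => y p ω),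
      condDistrib
        (fun ω (i : {i : Fin n // Sum.inl i ∉ S}) =>
          (φ i ω, proj (V (fun p : S => y p ω)) (y (Sum.inl i.1) ω)))
        (fun ω (p : S) => y p ω) (Pr[|P ⁻¹' {S}]) z
      = Measure.pi fun _ => labelledMixture w (fun k => (D k).map (proj (V z))) := by
  classical
  have := isProbabilityMeasure_labelledMixture (D := D) hw hw1
  have hZ : Measurable fun ω (p : S) => y p ω := measurable_pi_lambda _ fun p => h.measurable_point _
  have hX : ∀ i : Fin n, Measurable fun ω => (φ i ω, y (Sum.inl i) ω) := fun i =>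
    (h.measurable_label i).prodMk (h.measurable_point _)
  have hW : Measurable fun ω (i : {i : Fin n // Sum.inl i ∉ S}) => (φ i ω, y (Sum.inl i.1) ω) :=
    measurable_pi_lambda _ fun i => hX i
  have hS0 : Pr (P ⁻¹' {S}) ≠ 0 := by
    rw [hP.uniform S hS]
    simp
  have hindP : ∀ {β : Type} [MeasurableSpace β]
      (g : (Fin n → Fin r) × (Fin n ⊕ Fin m → E d) → β), Measurable g →
      (Pr[|P ⁻¹' {S}]).map (fun ω => g (fun i => φ i ω, fun p => y p ω))
        = Pr.map fun ω => g (fun i => φ i ω, fun p => y p ω) := fun g hg => by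
    refine map_cond_preimage_eq_of_indepFun hP.measurable (hg.comp ?_)
      (hP.indep.comp measurable_id hg) (measurableSet_singleton S) hS0
    exact (measurable_pi_lambda _ h.measurable_label).prodMk
      (measurable_pi_lambda _ h.measurable_point)
  have hlaw : (Pr[|P ⁻¹' {S}]).map (fun ω => ((fun p : S => y p ω),
      fun i : {i : Fin n // Sum.inl i ∉ S} => (φ i ω, y (Sum.inl i.1) ω)))
      = ((Pr[|P ⁻¹' {S}]).map fun ω (p : S) => y p ω).prod
        (Measure.pi fun _ => labelledMixture w D) := by
    have e1 := hindP (fun x => ((fun p : S => x.2 p),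
      fun i : {i : Fin n // Sum.inl i ∉ S} => (x.1 i, x.2 (Sum.inl i.1)))) (by fun_prop)
    have e2 := hindP (fun x (p : S) => x.2 p) (by fun_prop)
    rw [e1, e2, (indepFun_iff_map_prod_eq_prod_map_map hZ.aemeasurable hW.aemeasurable).1
      (h.indepFun_points S).symm]
    congr 1
    have e3 := iIndepFun.map_fun_eq_pi_map
      (fun i : {i : Fin n // Sum.inl i ∉ S} => (hX i).aemeasurable)
      (h.inlier_indep.precomp Subtype.val_injective)
    simp only [h.inlier_law] at e3
    exact e3
  let f : (S → E d) × ({i : Fin n // Sum.inl i ∉ S} → Fin r × E d) →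
      {i : Fin n // Sum.inl i ∉ S} → Fin r × E q := fun x i =>
    ((x.2 i).1, proj (V x.1) (x.2 i).2)
  have hf : Measurable f := by
    refine measurable_pi_lambda _ fun i => Measurable.prodMk (by fun_prop) ?_
    exact measurable_proj (V := fun x : (S → E d) ×
      ({i : Fin n // Sum.inl i ∉ S} → Fin r × E d) => V x.1)
      (fun a b => (hV a b).comp measurable_fst) (by fun_prop)
  filter_upwards [condDistrib_eq_map_of_map_prodMk_eq_prod hZ hW hlaw hf] with z hz
  refine hz.trans ?_
  have hproj : Measurable (proj (V z)) :=
    measurable_proj (V := fun _ : E d => V z) (fun _ _ => measurable_const) measurable_id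
  have hm : Measurable fun x : Fin r × E d => (x.1, proj (V z) x.2) := by fun_prop
  have := Measure.isProbabilityMeasure_map (μ := labelledMixture w D) hm.aemeasurable
  have e4 := Measure.pi_map_pi (ι := {i : Fin n // Sum.inl i ∉ S})
    (μ := fun _ => labelledMixture w D) (f := fun _ x => (x.1, proj (V z) x.2))
    fun _ => hm.aemeasurable
  simp only [map_prodMap_labelledMixture hproj] at e4
  exact e4

/-- Sub-gaussianity is preserved by projections. -/
lemma IsSubGaussian.map_proj {q : ℕ} {D : Measure (E d)} {a : E d} {ψ : ℝ}
    (h : IsSubGaussian D a ψ) {V : Matrix (Fin d) (Fin q) ℝ} (hV : Vᵀ * V = 1) :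
    IsSubGaussian (D.map (proj V)) (proj V a) ψ := by
  have hm : Measurable (proj V) :=
    measurable_proj (V := fun _ : E d => V) (fun _ _ => measurable_const) measurable_id
  let L : E d →L[ℝ] E q := LinearMap.toContinuousLinearMap (Matrix.toEuclideanLin Vᵀ)
  have hL : ∀ x, L x = proj V x := fun _ => rfl
  -- The adjoint of the projection. It is isometric by orthonormality, so the mgf bound transfers
  -- with the same parameter.
  let u : E q → E d := fun ν => ∑ j, ν j • column V j
  have hu : ∀ ν x, inner ℝ ν (proj V x - proj V a) = inner ℝ (u ν) (x - a) := fun ν x => by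
    rw [← hL, ← hL, ← map_sub, hL, PiLp.inner_apply, sum_inner]
    refine Finset.sum_congr rfl fun j _ => ?_
    rw [proj_apply, real_inner_smul_left]
    simp [mul_comm]
  have hun : ∀ ν, ‖u ν‖ = ‖ν‖ := fun ν => by
    have hv := orthonormal_column hV
    have : ‖u ν‖ ^ 2 = ‖ν‖ ^ 2 := by
      rw [← real_inner_self_eq_norm_sq, EuclideanSpace.norm_sq_eq, sum_inner]
      refine Finset.sum_congr rfl fun j _ => ?_
      rw [real_inner_smul_left, hv.inner_right_fintype, Real.norm_eq_abs, sq_abs, sq]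
    exact (sq_eq_sq₀ (norm_nonneg _) (norm_nonneg _)).1 this
  refine ⟨h.pos, ?_, ?_, fun ν => ?_, fun ν => ?_⟩
  · rw [integrable_map_measure (by fun_prop) hm.aemeasurable]
    exact L.integrable_comp h.integrable
  · rw [integral_map hm.aemeasurable (by fun_prop)]
    have := L.integral_comp_comm h.integrable
    simp only [hL, h.mean] at this
    exact this
  · rw [integrable_map_measure (by fun_prop) hm.aemeasurable]
    simpa only [Function.comp_def, hu] using h.integrable_exp (u ν)
  · rw [integral_map hm.aemeasurable (by fun_prop)]
    simpa only [hu, hun] using h.mgf_le (u ν)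

end Conditional

end SGMM

namespace SGMM

/-! ### The good event and the separation of the projected centres. -/

section Separation

variable {d r q : ℕ}

lemma half_minSep_le (hr : 2 ≤ r) {μ : Fin r → E d} {V : Matrix (Fin d) (Fin q) ℝ}
    (h : ∀ x ∈ Submodule.span ℝ (Set.range μ), ‖x‖ ≤ 2 * ‖proj V x‖) :
    minSep μ / 2 ≤ minSep fun k => proj V (μ k) := by
  have : Nonempty {p : Fin r × Fin r // p.1 ≠ p.2} :=
    ⟨⟨(⟨0, by omega⟩, ⟨1, by omega⟩), by simp⟩⟩
  refine le_ciInf fun p => ?_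
  have h1 : minSep μ ≤ ‖μ p.1.1 - μ p.1.2‖ :=
    ciInf_le (f := fun p : {p : Fin r × Fin r // p.1 ≠ p.2} => ‖μ p.1.1 - μ p.1.2‖)
      (Set.finite_range _).bddBelow p
  have h2 := h (μ p.1.1 - μ p.1.2) (Submodule.sub_mem _ (Submodule.subset_span ⟨_, rfl⟩)
    (Submodule.subset_span ⟨_, rfl⟩))
  have h3 : proj V (μ p.1.1 - μ p.1.2) = proj V (μ p.1.1) - proj V (μ p.1.2) :=
    map_sub (Matrix.toEuclideanLin Vᵀ) _ _
  rw [h3] at h2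
  linarith

variable {w : Fin r → ℝ} {μ : Fin r → E d} {D : Fin r → Measure (E d)} {ψ : Fin r → ℝ} {K : ℝ}

/-- Any nonzero vector in the span of the means (there is one as `r ≥ 2`) compares `H` with the
second moments of the mixture. This upper bound makes the eigenvalue condition restrict the
dimension. -/
lemma minPosEigenvalue_le [∀ k, IsProbabilityMeasure (D k)] (hr : 2 ≤ r) (hw : ∀ k, 0 < w k)
    (hw1 : ∑ k, w k = 1) (hD : ∀ k, IsSubGaussian (D k) (μ k) (ψ k))
    (hU : Module.finrank ℝ (Submodule.span ℝ (Set.range μ)) = r - 1)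
    (hK : IsSubGaussian ((labelledMixture w D).map Prod.snd) 0 K) :
    minPosEigenvalue (meanMatrix w μ) ≤ 8 * K ^ 2 := by
  have hne : Submodule.span ℝ (Set.range μ) ≠ ⊥ := fun h => by
    rw [h, finrank_bot] at hU
    omega
  obtain ⟨x, hx, hx0⟩ := Submodule.exists_mem_ne_zero_of_ne_bot hne
  have h1 := (minPosEigenvalue_mul_norm_sq_le hw hx).trans
    ((mixture_second_moment_bounds hw hw1 hD x).1.trans hK.integral_inner_sq_le)
  have : 0 < ‖x‖ := norm_pos_iff.2 hx0
  exact le_of_mul_le_mul_right h1 (by positivity)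

variable {Ω : Type*} [MeasurableSpace Ω] {Pr : Measure Ω} [IsProbabilityMeasure Pr] {n m M : ℕ}
  {φ : Fin n → Ω → Fin r} {y : Fin n ⊕ Fin m → Ω → E d} {P : Ω → Finset (Fin n ⊕ Fin m)}
  {V : (S : Finset (Fin n ⊕ Fin m)) → (S → E d) → Matrix (Fin d) (Fin (r - 1)) ℝ}

/-- With high probability, the projection to the principal components preserves the separation of
the centres. -/
theorem measureReal_separation_ge [∀ k, IsProbabilityMeasure (D k)] (hr : 2 ≤ r)
    (hd : 0 < d) (hdM : d ≤ M) (hM : 2 ≤ M) (hMN : M ≤ n + m)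
    (hw : ∀ k, 0 < w k) (hw1 : ∑ k, w k = 1) (hD : ∀ k, IsSubGaussian (D k) (μ k) (ψ k))
    (hμ : ∑ k, w k • μ k = 0)
    (hU : Module.finrank ℝ (Submodule.span ℝ (Set.range μ)) = r - 1)
    (hK : IsSubGaussian ((labelledMixture w D).map Prod.snd) 0 K)
    (hy : IsSample Pr w D φ y) (hP : IsRandomSplit Pr φ y M P) (hV : IsPCA M V)
    {u : ℝ} (hu : 0 ≤ u) (hu1 : u ≤ 1) (huM : M * u ^ 2 = d * Real.log M)
    (hη : ∀ᵐ ω ∂Pr, 5 * (sigmaMax D μ ^ 2 + 1160 * K ^ 2 * u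
      + 9 * ((m : ℝ) / (n + m : ℕ) + √(Real.log M / M))
        * max (maxSep μ ^ 2) (rowNorm (fun j : Fin m => y (Sum.inr j) ω) ^ 2))
      < minPosEigenvalue (meanMatrix w μ)) :
    1 - 5 / (M : ℝ) ≤ Pr.real {ω | minSep μ / 2 ≤
      minSep (fun k => proj (V (P ω) (fun p : P ω => y p ω)) (μ k))} := by
  classical
  have hM0 : (0 : ℝ) < M := by exact_mod_cast (by omega : 0 < M)
  have hM1 : (1 : ℝ) ≤ M := by exact_mod_cast (by omega : 1 ≤ M)
  have hL : 0 ≤ Real.log M := Real.log_nonneg hM1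
  have hLM : Real.log M ≤ M := (Real.log_le_sub_one_of_pos hM0).trans (by linarith)
  have hXm : ∀ i : Fin n, Measurable (y (Sum.inl i)) := fun i => hy.measurable_point _
  have hXD : ∀ i : Fin n, Pr.map (y (Sum.inl i)) = (labelledMixture w D).map Prod.snd := fun i => by
    rw [← hy.inlier_law i, Measure.map_map measurable_snd
      ((hy.measurable_label i).prodMk (hXm i))]
    rfl
  have hind : iIndepFun (fun i : Fin n => y (Sum.inl i)) Pr :=
    hy.inlier_indep.comp (fun _ x => x.2) fun _ => measurable_snd
  have hconc : ∀ S : Finset (Fin n ⊕ Fin m), ∃ B : Set (Fin n → E d), MeasurableSet B ∧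
      (S.card = M → Pr.real {ω | (fun i : Fin n => y (Sum.inl i) ω) ∈ B} ≤ 4 / M ∧
      ∀ z ∉ B, (∀ x : E d, |∑ i ∈ S.toLeft,
          (inner ℝ x (z i) ^ 2 - ∫ z, inner ℝ x z ^ 2 ∂((labelledMixture w D).map Prod.snd))|
          ≤ 1152 * K ^ 2 * u * M * ‖x‖ ^ 2) ∧
        ‖∑ i ∈ S.toLeft, z i‖ ^ 2 ≤ 4 * K ^ 2 * u ^ 2 * M ^ 2) := fun S => by
    by_cases hS : S.card = M
    · have hs : S.toLeft.card ≤ M := by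
        have := Finset.card_toLeft_add_card_toRight (u := S)
        omega
      obtain ⟨B, h1, h2⟩ := exists_measurableSet_concentration hind hXm hXD hK S.toLeft hs hd hdM
        hM hu hu1 huM
      exact ⟨B, h1, fun _ => h2⟩
    -- Sets of the wrong size get a dummy value, so that `B` is defined for all `S`; `P` never takes
    -- them.
    · exact ⟨∅, MeasurableSet.empty, fun h => absurd h hS⟩
  choose B hBm hB using hconc
  let B' : Finset (Fin n ⊕ Fin m) → Set (Fin n ⊕ Fin m → E d) := fun S =>
    (fun z i => z (Sum.inl i)) ⁻¹' B S
  have hbad1 : Pr.real {ω | (fun p => y p ω) ∈ B' (P ω)} ≤ 4 / M :=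
    hP.measureReal_mem_le hy.measurable_point
      (fun S => (by fun_prop : Measurable fun (z : Fin n ⊕ Fin m → E d) (i : Fin n) =>
        z (Sum.inl i)) (hBm S)) (by positivity) fun S hS => (hB S hS).1
  have hbad2 := hP.measureReal_card_toRight_le (by omega) hMN
  have hbad3 := ae_iff.1 hη
  set bad1 := {ω | (fun p => y p ω) ∈ B' (P ω)}
  set bad2 := {ω | 3 * (m * M / (n + m : ℕ) + Real.log M) < ((P ω).toRight.card : ℝ)}
  set bad3 := {ω | ¬ 5 * (sigmaMax D μ ^ 2 + 1160 * K ^ 2 * u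
      + 9 * ((m : ℝ) / (n + m : ℕ) + √(Real.log M / M))
        * max (maxSep μ ^ 2) (rowNorm (fun j : Fin m => y (Sum.inr j) ω) ^ 2))
      < minPosEigenvalue (meanMatrix w μ)}
  set G := {ω | minSep μ / 2 ≤ minSep (fun k => proj (V (P ω) (fun p : P ω => y p ω)) (μ k))}
  have hcover : Set.univ ⊆ G ∪ (bad1 ∪ (bad2 ∪ bad3)) := by
    intro ω _
    by_contra hω
    simp only [Set.mem_union, not_or] at hω
    obtain ⟨hG, h1, h2, h3⟩ := hω
    apply hG
    have h3' := not_not.1 h3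
    have h2' : ((P ω).toRight.card : ℝ) ≤ 3 * (m * M / (n + m : ℕ) + Real.log M) := not_lt.1 h2
    obtain ⟨hcov, hmean⟩ := (hB (P ω) (hP.card_eq ω)).2 (fun i => y (Sum.inl i) ω) h1
    set R := max (maxSep μ ^ 2) (rowNorm (fun j : Fin m => y (Sum.inr j) ω) ^ 2) with hRdef
    have hR0 : 0 ≤ R := (sq_nonneg _).trans (le_max_left _ _)
    have hdev := abs_sampleCov_sub_le (z := fun p => y p ω) (S := P ω) (hP.card_eq ω)
      (by omega)
      (A := fun x => ∫ z, inner ℝ x z ^ 2 ∂((labelledMixture w D).map Prod.snd))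
      (h := fun x => ∑ k, w k * inner ℝ (μ k) x ^ 2)
      (a := 1152 * K ^ 2 * u) (b := 4 * K ^ 2 * u ^ 2) (R := R)
      (ρ := 3 * ((m : ℝ) / (n + m : ℕ) + √(Real.log M / M))) (σ := sigmaMax D μ)
      (by positivity)
      (fun x => Finset.sum_nonneg fun k _ => mul_nonneg (hw k).le (sq_nonneg _))
      (fun x => (sum_mul_inner_sq_le_maxSep hw hw1 hμ x).trans
        (mul_le_mul_of_nonneg_right (le_max_left _ _) (sq_nonneg _)))
      (fun x => (mixture_second_moment_bounds hw hw1 hD x).1)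
      (fun x => (mixture_second_moment_bounds hw hw1 hD x).2)
      (fun j => le_max_of_le_right (pow_le_pow_left₀ (norm_nonneg _)
        (norm_le_rowNorm (fun j : Fin m => y (Sum.inr j) ω) j) 2))
      hR0
      (by
        refine h2'.trans ?_
        -- The tail bound for the outliers gives `log M / M`, which is at most `1` and hence below
        -- its square root.
        have h4 : Real.log M / M ≤ √(Real.log M / M) :=
          Real.le_sqrt_of_sq_le (by
            have h5 : 0 ≤ Real.log M / M := by positivity
            have h6 : Real.log M / M ≤ 1 := (div_le_one hM0).2 hLM
            nlinarith)
        rw [div_le_iff₀ hM0] at h4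
        have h7 : (m : ℝ) * M / (n + m : ℕ) = m / (n + m : ℕ) * M := by ring
        rw [h7]
        linarith)
      hcov hmean
    -- The sample mean contributes `8 K² u²`, which merges with `1152 K² u` into `1160 K² u`.
    have hu2 : u ^ 2 ≤ u := by nlinarith
    have hKu : K ^ 2 * u ^ 2 ≤ K ^ 2 * u := by gcongr
    have hδ0 : 0 ≤ 1152 * K ^ 2 * u + sigmaMax D μ ^ 2 + 2 * (4 * K ^ 2 * u ^ 2)
        + 3 * (3 * ((m : ℝ) / (n + m : ℕ) + √(Real.log M / M))) * R := by positivity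
    refine half_minSep_le hr fun x hx => norm_le_two_mul_norm_proj
      (isHermitian_sampleCov fun p : P ω => y p ω)
      (dotProduct_sampleCov_mulVec_nonneg _)
      (hV.top (P ω) (hP.card_eq ω) _) hw hU hdev hδ0 ?_ hx
    refine lt_of_le_of_lt ?_ h3'
    nlinarith
  have h4 : (1 : ℝ) ≤ Pr.real G + (4 / M + (1 / M + 0)) := by
    calc (1 : ℝ) = Pr.real Set.univ := by simp
      _ ≤ Pr.real (G ∪ (bad1 ∪ (bad2 ∪ bad3))) := measureReal_mono hcover
      _ ≤ Pr.real G + (Pr.real bad1 + (Pr.real bad2 + Pr.real bad3)) :=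
          (measureReal_union_le _ _).trans (add_le_add le_rfl
            ((measureReal_union_le _ _).trans (add_le_add le_rfl (measureReal_union_le _ _))))
      _ ≤ _ := by
          have : Pr.real bad3 = 0 := by rw [measureReal_def, hbad3, ENNReal.toReal_zero]
          rw [this]
          gcongr
  have h5 : (5 : ℝ) / M = 4 / M + (1 / M + 0) := by ring
  linarith

end Separation

end SGMM

/-! ### The theorem: constants, and reduction to the regime where concentration applies. -/

theorem mainTheorem4 :
    ∃ (c₁ C₂ C : ℝ) (a : ℕ), 0 < c₁ ∧ 0 < C₂ ∧ 0 < C ∧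
    ∀ {Ω : Type*} [MeasurableSpace Ω] (Pr : Measure Ω) [IsProbabilityMeasure Pr]
      (n m d r N₂ : ℕ) [NeZero r] (α K : ℝ)
      (w : Fin r → ℝ) (μ : Fin r → SGMM.E d) (D : Fin r → Measure (SGMM.E d))
      [∀ k, IsProbabilityMeasure (D k)] (ψ : Fin r → ℝ)
      (φ : Fin n → Ω → Fin r) (y : Fin n ⊕ Fin m → Ω → SGMM.E d)
      (P : Ω → Finset (Fin n ⊕ Fin m))
      (V : (S : Finset (Fin n ⊕ Fin m)) → (S → SGMM.E d) → Matrix (Fin d) (Fin (r - 1)) ℝ),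
      2 ≤ r → 0 < n → 2 ≤ n + m →
      0 < α → α < 1 → (N₂ : ℝ) = ((n + m : ℕ) : ℝ) ^ α →
      -- mixture weights, and component laws with mean `μ k` and sub-gaussian parameter `ψ k`
      (∀ k, 0 < w k) → ∑ k, w k = 1 →
      (∀ k, SGMM.IsSubGaussian (D k) (μ k) (ψ k)) →
      -- the means are centred and span an `r - 1` dimensional space
      ∑ k, w k • μ k = 0 →
      Module.finrank ℝ (Submodule.span ℝ (Set.range μ)) = r - 1 →
      -- `K` is a sub-gaussian parameter of the (centred) inlier distribution
      SGMM.IsSubGaussian ((SGMM.labelledMixture w D).map Prod.snd) 0 K →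
      SGMM.IsSample Pr w D φ y →
      SGMM.IsRandomSplit Pr φ y N₂ P →
      SGMM.IsPCA N₂ V →
      -- the eigenvalue condition
      (∀ᵐ ω ∂Pr,
        5 * (SGMM.sigmaMax D μ ^ 2
          + c₁ * K ^ 2 *
              √(2 * α * d * ((n + m : ℕ) : ℝ) ^ (1 - α) * Real.log ((n + m : ℕ) : ℝ) / n)
          + C₂ * ((m : ℝ) / ((n + m : ℕ) : ℝ)
                + √(α * Real.log ((n + m : ℕ) : ℝ) / ((n + m : ℕ) : ℝ) ^ α))
              * max (SGMM.maxSep μ ^ 2)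
                  (SGMM.rowNorm (fun j : Fin m => y (Sum.inr j) ω) ^ 2))
          < SGMM.minPosEigenvalue (SGMM.meanMatrix w μ)) →
      -- given the split and the points used for PCA, the remaining inliers (with their labels)
      -- are projected to an independent sample from a sub-gaussian mixture in dimension `r - 1`
      (∀ S : Finset (Fin n ⊕ Fin m), S.card = N₂ →
        (∀ᵐ z ∂(Pr[|P ⁻¹' {S}]).map (fun ω (p : S) => y p ω),
          condDistrib
            (fun ω (i : {i : Fin n // Sum.inl i ∉ S}) =>
              (φ i ω, SGMM.proj (V S (fun p : S => y p ω)) (y (Sum.inl i.1) ω)))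
            (fun ω (p : S) => y p ω) (Pr[|P ⁻¹' {S}]) z
          = Measure.pi fun _ =>
              SGMM.labelledMixture w (fun k => (D k).map (SGMM.proj (V S z)))) ∧
        ∀ (z : S → SGMM.E d) (k : Fin r),
          SGMM.IsSubGaussian ((D k).map (SGMM.proj (V S z))) (SGMM.proj (V S z) (μ k)) (ψ k)) ∧
      -- the separation of the centres survives the projection
      1 - C * (r : ℝ) ^ 2 * Real.log ((n + m : ℕ) : ℝ) ^ a * ((n + m : ℕ) : ℝ) ^ (-α) ≤
        Pr.real {ω | SGMM.minSep μ / 2 ≤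
          SGMM.minSep (fun k => SGMM.proj (V (P ω) (fun p : P ω => y p ω)) (μ k))} := by
  -- The failure probability is in fact at most `5 / N₂ = 5 N ^ (-α)`, so no logarithm is needed and
  -- `a = 0`.
  refine ⟨1160, 9, 5, 0, by norm_num, by norm_num, by norm_num, ?_⟩
  intro Ω _ Pr _ n m d r N₂ _ α K w μ D _ ψ φ y P V hr hn hN hα hα1 hN₂ hw hw1 hD hμ hU hK hy hP hV
    hη
  refine ⟨fun S hS => ⟨SGMM.condDistrib_projected_inliers hw hw1 hy hP hS (hV.measurable S),
    fun z k => (hD k).map_proj (hV.top S hS z).1⟩, ?_⟩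
  have hn0 : (0 : ℝ) < n := by exact_mod_cast hn
  have hN1 : (1 : ℝ) < ((n + m : ℕ) : ℝ) := by exact_mod_cast (by omega : 1 < n + m)
  have hN0 : (0 : ℝ) < ((n + m : ℕ) : ℝ) := by linarith
  have hnN : (n : ℝ) ≤ ((n + m : ℕ) : ℝ) := by exact_mod_cast Nat.le_add_right n m
  have hM1 : (1 : ℝ) < N₂ := by
    rw [hN₂]
    exact Real.one_lt_rpow hN1 hα
  have hM2 : 2 ≤ N₂ := by exact_mod_cast hM1
  have hM2' : (2 : ℝ) ≤ N₂ := by exact_mod_cast hM2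
  have hM0 : (0 : ℝ) < N₂ := by linarith
  have hMN : N₂ ≤ n + m := by
    have : (N₂ : ℝ) ≤ ((n + m : ℕ) : ℝ) := by
      rw [hN₂]
      conv_rhs => rw [← Real.rpow_one ((n + m : ℕ) : ℝ)]
      exact Real.rpow_le_rpow_of_exponent_le hN1.le hα1.le
    exact_mod_cast this
  have hd : 0 < d := by
    by_contra h0
    have h1 := Submodule.finrank_le (Submodule.span ℝ (Set.range μ))
    rw [hU, finrank_euclideanSpace_fin] at h1
    omega
  have hd0 : (0 : ℝ) < d := by exact_mod_cast hd
  have hlog : Real.log N₂ = α * Real.log ((n + m : ℕ) : ℝ) := by rw [hN₂, Real.log_rpow hN0]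
  have hL0 : 1 / 2 < Real.log N₂ := by
    have h1 := Real.log_two_gt_d9
    have h2 := Real.log_le_log (by norm_num) hM2'
    linarith
  have hpow : ((n + m : ℕ) : ℝ) ^ (1 - α) = ((n + m : ℕ) : ℝ) / N₂ := by
    rw [Real.rpow_sub hN0, Real.rpow_one, ← hN₂]
  set u : ℝ := √(d * Real.log N₂ / N₂) with hu
  have hu2 : u ^ 2 = d * Real.log N₂ / N₂ := Real.sq_sqrt (by positivity)
  -- The radicand on the right is `u²` times `2 N / n ≥ 1`.
  have hus : u ≤ √(2 * α * d * ((n + m : ℕ) : ℝ) ^ (1 - α) * Real.log ((n + m : ℕ) : ℝ) / n) := by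
    refine Real.sqrt_le_sqrt ?_
    have h1 : 2 * α * d * ((n + m : ℕ) : ℝ) ^ (1 - α) * Real.log ((n + m : ℕ) : ℝ) / n
        = d * Real.log N₂ / N₂ * (2 * (((n + m : ℕ) : ℝ) / n)) := by
      rw [hpow, hlog]
      field_simp
    rw [h1]
    refine le_mul_of_one_le_right (by positivity) ?_
    have : 1 ≤ ((n + m : ℕ) : ℝ) / n := (one_le_div hn0).2 hnN
    linarith
  have hK0 := hK.pos
  have hη' : ∀ᵐ ω ∂Pr, 5 * (SGMM.sigmaMax D μ ^ 2 + 1160 * K ^ 2 * u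
      + 9 * ((m : ℝ) / ((n + m : ℕ) : ℝ) + √(Real.log N₂ / N₂))
        * max (SGMM.maxSep μ ^ 2) (SGMM.rowNorm (fun j : Fin m => y (Sum.inr j) ω) ^ 2))
      < SGMM.minPosEigenvalue (SGMM.meanMatrix w μ) := by
    filter_upwards [hη] with ω hω
    refine lt_of_le_of_lt ?_ hω
    rw [← hlog, ← hN₂]
    gcongr
  -- The condition gives `5 * 1160 * K² u < 8 K²`. It holds almost surely, so one sample point at
  -- which it holds is enough for this deterministic conclusion.
  have hu1 : u < 1 / 2 := by
    obtain ⟨ω, hω⟩ := hη'.exists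
    have h1 := SGMM.minPosEigenvalue_le hr hw hw1 hD hU hK
    have h2 : 0 ≤ 9 * ((m : ℝ) / ((n + m : ℕ) : ℝ) + √(Real.log N₂ / N₂))
        * max (SGMM.maxSep μ ^ 2) (SGMM.rowNorm (fun j : Fin m => y (Sum.inr j) ω) ^ 2) := by
      positivity
    have h3 : K ^ 2 * (5 * 1160 * u) < K ^ 2 * 8 := by
      have := sq_nonneg (SGMM.sigmaMax D μ)
      linarith
    have h4 := lt_of_mul_lt_mul_left h3 (sq_nonneg K)
    linarith
  have hu0 : 0 ≤ u := Real.sqrt_nonneg _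
  -- `d log N₂ = u² N₂ ≤ N₂ / 4`, and `log N₂ > 1 / 2` because `N₂ ≥ 2`.
  have hdM : d ≤ N₂ := by
    have h1 : d * Real.log N₂ = u ^ 2 * N₂ := by
      rw [hu2]
      field_simp
    have h2 : u ^ 2 ≤ 1 / 4 := by nlinarith
    have : (d : ℝ) ≤ N₂ := by nlinarith
    exact_mod_cast this
  refine le_trans ?_ (SGMM.measureReal_separation_ge hr hd hdM hM2 hMN hw hw1 hD hμ hU hK hy hP hV
    hu0 (by linarith) (by rw [hu2]; field_simp) hη')
  rw [Real.rpow_neg hN0.le, ← hN₂, pow_zero, mul_one, div_eq_mul_inv]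
  have hr2 : (1 : ℝ) ≤ (r : ℝ) ^ 2 := one_le_pow₀ (by exact_mod_cast (by omega : 1 ≤ r))
  have : (0 : ℝ) ≤ (N₂ : ℝ)⁻¹ := by positivity
  nlinarith
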